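/- Let $A$ and $B$ be $C^*$-algebras, let $E_B$ be a right Hilbert $B$-module, let $S$ be a set, and let $k:S\times S\to\mathbb B(A,\mathcal L(E_B))$ be a map. Here $\mathcal L(E_B,E)$ denotes the space of adjointable operators between right Hilbert $B$-modules, $\mathcal L(E)=\mathcal L(E,E)$, and $\mathbb B(A,\mathcal L(E_B))$ denotes the bounded linear maps. An $A$-$B$-$C^*$-correspondence is a right Hilbert $B$-module $E$ together with a nondegenerate $^*$-homomorphism $\varphi_E:A\to\mathcal L(E)$, i.e. $\varphi_E(A)E$ is linearly dense in $E$. An approximate unit of $A$ is a net $(e_i)$ of positive elements with $\|e_i\|\le 1$ such that $e_ia\to a$ and $ae_i\to a$ for all $a\in A$. A net $(T_i)$ in $\mathcal L(E_B)$ converges strictly to $T\in\mathcal L(E_B)$ if $T_i\xi\to T\xi$ and $T_i^*\xi\to T^*\xi$ for all $\xi\in E_B$. The following are equivalent: 1. There exist an $A$-$B$-$C^*$-correspondence $E$ and a map $\zeta:S\to\mathcal L(E_B,E)$ such that $$k(s,t)(a)=\zeta(s)^*\varphi_E(a)\zeta(t),\qquad s,t\in S,\ a\in A.$$ 2. $k$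 is positive-definite, i.e. for all $n\in\mathbb N$, $s_1,\dots,s_n\in S$, $a_1,\dots,a_n\in A$ and $\xi_1,\dots,\xi_n\in E_B$, $$\sum_{i,j=1}^n\langle\xi_i,k(s_i,s_j)(a_i^*a_j)\xi_j\rangle_B\ge 0,$$ and $k$ is strict, i.e. for each $s\in S$ the net $(k(s,s)(e_i))_i$ converges strictly in $\mathcal L(E_B)$ for some (equivalently, under the positive-definiteness of $k$, for every) approximate unit $(e_i)_i$ of $A$. If these conditions hold, then the pair $(\zeta,E)$ in 1. may be chosen to be minimal, i.e. such that $\{\varphi_E(a)\zeta(s)\xi: a\in A,\ s\in S,\ \xi\in E_B\}$ is linearly dense in $E$. If $(\zeta,E)$ and $(\zeta',E')$ are two minimal pairs as in 1., then there is a unique unitary isomorphism of $C^*$-correspondences $U:E\to E'$ (a unitary $U\in\mathcal L(E,E')$ with $U\varphi_E(a)=\varphi_{E'}(a)U$ for all $a\in A$) such that $U\zeta(s)=\zeta'(s)$ for all $s\in S$. -/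

import Mathlib

open Filter Topology

universe u v w x y y₁ y₂

/-! ### Right Hilbert modules

Mathlib's `CStarModule C E` is a Hilbert module with an action `c • x` satisfying
`inner C x (c • y) = c * inner C x y`.  For `C = Bᵐᵒᵖ` this is exactly a *right* Hilbert
`B`-module: `x · b` is `MulOpposite.op b • x`, and `⟨x, y⟩_B` is `inner Bᵐᵒᵖ x y` read in `B`;
the norm of `E` is `‖⟨x, x⟩‖ ^ (1/2)`, and completeness is the instance `CompleteSpace E`. -/

section Adjointable

/-- The `B`-valued inner product of a right Hilbert `B`-module
(conjugate-linear in the first variable, `B`-linear in the second one). -/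
def rightInner (B : Type*) {E : Type*} [Inner Bᵐᵒᵖ E] (x y : E) : B :=
  MulOpposite.unop (inner Bᵐᵒᵖ x y)

variable (B : Type*) [NonUnitalCStarAlgebra B] [PartialOrder B]
variable (E : Type*) [NormedAddCommGroup E] [NormedSpace ℂ E] [SMul Bᵐᵒᵖ E] [CStarModule Bᵐᵒᵖ E]
variable (F : Type*) [NormedAddCommGroup F] [NormedSpace ℂ F] [SMul Bᵐᵒᵖ F] [CStarModule Bᵐᵒᵖ F]
variable (G : Type*) [NormedAddCommGroup G] [NormedSpace ℂ G] [SMul Bᵐᵒᵖ G] [CStarModule Bᵐᵒᵖ G]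

variable {E} in
theorem rightInner_op_smul_right (x y : E) (b : B) :
    rightInner B x (MulOpposite.op b • y) = rightInner B x y * b := by
  simp [rightInner]

variable {E} in
theorem star_rightInner (x y : E) : star (rightInner B x y) = rightInner B y x := by
  rw [rightInner, ← MulOpposite.unop_star, CStarModule.star_inner, rightInner]

variable {E} in
theorem rightInner_self_nonneg (x : E) : 0 ≤ rightInner B x x :=
  MulOpposite.unop_nonneg.2 CStarModule.inner_self_nonneg

variable {E} in
theorem rightInner_left_injective {x y : E}
    (h : ∀ z : E, rightInner B z x = rightInner B z y) : x = y := by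
  have h' : inner Bᵐᵒᵖ (x - y) (x - y) = 0 := by
    rw [CStarModule.inner_sub_right, sub_eq_zero]
    exact MulOpposite.unop_injective (h (x - y))
  exact sub_eq_zero.1 (CStarModule.inner_self.1 h')

/-- The adjointable operators `E → F`, as a subspace of the bounded linear operators
(maps with an adjoint, and the adjoints themselves, are automatically linear and bounded). -/
def adjointableSubmodule : Submodule ℂ (E →L[ℂ] F) where
  carrier := {T | ∃ T' : F →L[ℂ] E, ∀ x y, rightInner B (T x) y = rightInner B x (T' y)}
  zero_mem' := ⟨0, fun x y => by simp [rightInner]⟩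
  add_mem' := by
    rintro T R ⟨T', hT⟩ ⟨R', hR⟩
    refine ⟨T' + R', fun x y => ?_⟩
    have h1 := hT x y
    have h2 := hR x y
    simp only [rightInner] at h1 h2 ⊢
    simp [h1, h2]
  smul_mem' := by
    rintro c T ⟨T', hT⟩
    refine ⟨star c • T', fun x y => ?_⟩
    have h1 := hT x y
    simp only [rightInner] at h1 ⊢
    simp [h1]

/-- The space `𝓛(E, F)` of adjointable operators, with the operator norm. -/
abbrev Adjointable : Type _ := ↥(adjointableSubmodule B E F)

instance : CoeFun (Adjointable B E F) (fun _ => E → F) := ⟨fun T => T.1⟩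

namespace Adjointable

variable {B E F G}

theorem ext' {T R : Adjointable B E F} (h : ∀ x, T x = R x) : T = R :=
  Subtype.ext (ContinuousLinearMap.ext h)

/-- The adjoint `T* : F → E` of an adjointable operator `T : E → F`. -/
noncomputable def adjoint (T : Adjointable B E F) : Adjointable B F E :=
  ⟨Classical.choose T.2, T.1, fun y x => by
    rw [← star_rightInner, ← star_rightInner B (T.1 x) y]
    exact congrArg star (Classical.choose_spec T.2 x y).symm⟩

theorem rightInner_adjoint_right (T : Adjointable B E F) (x : E) (y : F) :
    rightInner B x (adjoint T y) = rightInner B (T x) y :=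
  (Classical.choose_spec T.2 x y).symm

theorem eq_adjoint {T : Adjointable B E F} {R : Adjointable B F E}
    (h : ∀ x y, rightInner B x (R y) = rightInner B (T x) y) : R = adjoint T :=
  ext' fun y => rightInner_left_injective B fun x => by rw [h, rightInner_adjoint_right]

theorem rightInner_adjoint_left (T : Adjointable B E F) (x : E) (y : F) :
    rightInner B (adjoint T y) x = rightInner B y (T x) := by
  rw [← star_rightInner, rightInner_adjoint_right, star_rightInner]

theorem adjoint_adjoint (T : Adjointable B E F) : adjoint (adjoint T) = T :=
  (eq_adjoint fun y x => (rightInner_adjoint_left T x y).symm).symm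

/-- Composition of adjointable operators. -/
noncomputable def comp (T : Adjointable B F G) (R : Adjointable B E F) : Adjointable B E G :=
  ⟨T.1.comp R.1, (adjoint R).1.comp (adjoint T).1, fun x y => by
    simp only [ContinuousLinearMap.comp_apply]
    rw [rightInner_adjoint_right, rightInner_adjoint_right]⟩

theorem comp_apply (T : Adjointable B F G) (R : Adjointable B E F) (x : E) :
    comp T R x = T (R x) := rfl

/-- The identity operator. -/
def id : Adjointable B E E := ⟨ContinuousLinearMap.id ℂ E, ContinuousLinearMap.id ℂ E,
  fun _ _ => rfl⟩

/-- `𝓛(E) = 𝓛(E, E)` is a ring under composition. -/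
noncomputable instance : Ring (Adjointable B E E) :=
  { (inferInstance : AddCommGroup (Adjointable B E E)) with
    mul := comp
    one := id
    mul_assoc := fun _ _ _ => rfl
    one_mul := fun _ => rfl
    mul_one := fun _ => rfl
    zero_mul := fun _ => rfl
    mul_zero := fun T => ext' fun _ => map_zero T.1
    left_distrib := fun T _ _ => ext' fun _ => map_add T.1 _ _
    right_distrib := fun _ _ _ => rfl }

/-- `𝓛(E)` is a `*`-ring with the adjoint as involution. -/
noncomputable instance : StarRing (Adjointable B E E) where
  star := adjoint
  star_involutive := adjoint_adjoint
  star_mul T R := (eq_adjoint fun x y => by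
    change rightInner B x (adjoint R (adjoint T y)) = rightInner B (T (R x)) y
    rw [rightInner_adjoint_right, rightInner_adjoint_right]).symm
  star_add T R := (eq_adjoint fun x y => by
    have h1 := rightInner_adjoint_right T x y
    have h2 := rightInner_adjoint_right R x y
    change rightInner B x (adjoint T y + adjoint R y) = rightInner B (T x + R x) y
    simp only [rightInner] at h1 h2 ⊢
    simp [h1, h2]).symm

/-- `U` is unitary: `U* U = 1` and `U U* = 1`. -/
def IsUnitary (U : Adjointable B E F) : Prop :=
  comp (adjoint U) U = id ∧ comp U (adjoint U) = id

/-- Convergence `T i → R` along `l` in the strict topology of `𝓛(E, F)`, that is, for the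
seminorms `T ↦ ‖T x‖` and `T ↦ ‖T* y‖`. -/
def StrictlyTendsto {ι : Type*} (T : ι → Adjointable B E F) (l : Filter ι)
    (R : Adjointable B E F) : Prop :=
  (∀ x, Tendsto (fun i => T i x) l (𝓝 (R x))) ∧
    ∀ y, Tendsto (fun i => adjoint (T i) y) l (𝓝 (adjoint R y))

end Adjointable

end Adjointable

/-- A `C*`-correspondence from `A` to `B`: a right Hilbert `B`-module `E` with a nondegenerate
`*`-homomorphism `A → 𝓛(E)`. -/
structure CStarCorrespondence (A : Type u) [NonUnitalCStarAlgebra A]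
    (B : Type v) [NonUnitalCStarAlgebra B] [PartialOrder B] where
  carrier : Type w
  [normedAddCommGroup : NormedAddCommGroup carrier]
  [normedSpace : NormedSpace ℂ carrier]
  [completeSpace : CompleteSpace carrier]
  [rightSMul : SMul Bᵐᵒᵖ carrier]
  [cstarModule : CStarModule Bᵐᵒᵖ carrier]
  leftAction : A →⋆ₙₐ[ℂ] Adjointable B carrier carrier
  nondegenerate :
    Dense (Submodule.span ℂ {x : carrier | ∃ a y, x = leftAction a y} : Set carrier)

namespace CStarCorrespondence

attribute [instance] normedAddCommGroup normedSpace completeSpace rightSMul cstarModule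

instance {A B : Type*} [NonUnitalCStarAlgebra A] [NonUnitalCStarAlgebra B] [PartialOrder B] :
    CoeSort (CStarCorrespondence A B) (Type _) := ⟨carrier⟩

/-- `U : E → E'` is a unitary isomorphism of correspondences: a unitary adjointable operator
(hence right `B`-linear) that intertwines the left actions of `A`. -/
def IsUnitaryIso {A B : Type*} [NonUnitalCStarAlgebra A] [NonUnitalCStarAlgebra B]
    [PartialOrder B] {E E' : CStarCorrespondence A B} (U : Adjointable B E E') : Prop :=
  U.IsUnitary ∧ ∀ a : A, U.comp (E.leftAction a) = (E'.leftAction a).comp U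

end CStarCorrespondence

section Kernels

variable {S A B F : Type*} [NonUnitalCStarAlgebra A] [NonUnitalCStarAlgebra B] [PartialOrder B]
variable [NormedAddCommGroup F] [NormedSpace ℂ F] [SMul Bᵐᵒᵖ F] [CStarModule Bᵐᵒᵖ F]

/-- The kernel `k : S × S → 𝔹(A, 𝓛(F))` is positive-definite. -/
def IsPositiveDefiniteKernel (k : S → S → A →L[ℂ] Adjointable B F F) : Prop :=
  ∀ (n : ℕ) (s : Fin n → S) (a : Fin n → A) (ξ : Fin n → F),
    0 ≤ ∑ i, ∑ j, rightInner B (ξ i) (k (s i) (s j) (star (a i) * a j) (ξ j))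

/-- `T : A → 𝓛(F)` is strict along the approximate unit `l` of `A` (given as a filter; for a net
`e : ι → A` this is `Filter.map e atTop`): `T e` converges strictly in `𝓛(F)` as `e` runs
along `l`. -/
def IsStrictAlong (T : A →L[ℂ] Adjointable B F F) (l : Filter A) : Prop :=
  ∃ R : Adjointable B F F, Adjointable.StrictlyTendsto (fun e : A => T e) l R

/-- The pair `(ζ, E)` is a decomposition of `k`: `k(s,t)(a) = ζ(s)* φ_E(a) ζ(t)`. -/
def IsDecomposition (k : S → S → A →L[ℂ] Adjointable B F F) (E : CStarCorrespondence A B)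
    (ζ : S → Adjointable B F E) : Prop :=
  ∀ (s t : S) (a : A), k s t a = (ζ s).adjoint.comp ((E.leftAction a).comp (ζ t))

/-- The pair `(ζ, E)` is minimal: the vectors `a ζ(s) ξ` are linearly dense in `E`. -/
def IsMinimalPair (E : CStarCorrespondence A B) (ζ : S → Adjointable B F E) : Prop :=
  Dense (Submodule.span ℂ {x : E | ∃ (a : A) (s : S) (ξ : F), x = E.leftAction a (ζ s ξ)} : Set E)

end Kernels

/-! A kernel `ζ(s)* φ(a) ζ(t)` is positive-definite because the double sum equals `⟨v, v⟩` for `v =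
∑ φ(a_i) ζ(s_i) ξ_i`. It is strict because `φ(e) → 1` pointwise along an approximate unit
(`tendsto_leftAction`), by nondegeneracy and contractivity of `φ`.

The converse is a GNS-Kolmogorov construction. Formal vectors `a ⊗ s ⊗ ξ` get the form `⟨a ⊗ s ⊗ ξ,
b ⊗ t ⊗ η⟩ = ⟨ξ, k(s,t)(a* b) η⟩`, which is positive semidefinite by hypothesis, and `E` is the
separated completion. Left multiplication by `a` is bounded by `‖a‖` (`norm_toCompl_leftMul_le`), so
`A` acts on `E`.

The vector `ζ(s) ξ` should be `1 ⊗ s ⊗ ξ`, but `A` need not have a unit. It is taken as the limit of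
`e ⊗ s ⊗ ξ` along an approximate unit (`exists_tendsto_elem`). Strictness makes this Cauchy: since
`e² ≤ e`, the squared distance between two such vectors is controlled by terms whose limits are
known. The adjoint is `b ⊗ t ⊗ η ↦ k(s,t)(b) η` (`exists_adjointable`).

Uniqueness holds because the inner products of the vectors `φ(a) ζ(s) ξ` depend on `k` only, so
matching them is isometric, and minimality makes them linearly dense on both sides. -/

/-! ### Semi-inner product modules and the Cauchy-Schwarz inequality -/

/-- A semi-inner product module over `C`: like a `CStarModule`, but without completeness and
without definiteness of the form. -/
structure PreHilbertModule (C W : Type*) [NonUnitalCStarAlgebra C] [PartialOrder C]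
    [AddCommGroup W] [Module ℂ W] where
  form : W → W →ₗ[ℂ] C
  smul : C → W →ₗ[ℂ] W
  star_form : ∀ x y, star (form x y) = form y x
  form_self_nonneg : ∀ x, 0 ≤ form x x
  form_smul : ∀ c x y, form x (smul c y) = c * form x y

namespace PreHilbertModule

variable {C W : Type*} [NonUnitalCStarAlgebra C] [PartialOrder C]
  [AddCommGroup W] [Module ℂ W] (H : PreHilbertModule C W)

theorem form_add_left (x y z : W) : H.form (x + y) z = H.form x z + H.form y z := by
  rw [← H.star_form, map_add, star_add, H.star_form, H.star_form]

theorem form_sub_left (x y z : W) : H.form (x - y) z = H.form x z - H.form y z := by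
  rw [← H.star_form, map_sub, star_sub, H.star_form, H.star_form]

theorem form_complex_smul_left (c : ℂ) (x y : W) : H.form (c • x) y = star c • H.form x y := by
  rw [← H.star_form, map_smul, star_smul, H.star_form]

theorem form_smul_left (c : C) (x y : W) : H.form (H.smul c x) y = H.form x y * star c := by
  rw [← H.star_form, H.form_smul, star_mul, H.star_form]

variable [StarOrderedRing C]

/-- With `a = ⟨x, y⟩`, expand `0 ≤ ⟨a x - t y, a x - t y⟩` and bound `a ⟨x, x⟩ a*` by `t a a*`. What
remains is `t a a* ≤ t² ⟨y, y⟩`. The strict bound on `t` gives `t > 0`, so one factor `t` cancels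
even when `⟨x, x⟩ = 0`. -/
theorem form_mul_form_swap_le (x y : W) {t : ℝ} (ht : ‖H.form x x‖ < t) :
    H.form x y * H.form y x ≤ t • H.form y y := by
  have ht0 : 0 < t := (norm_nonneg _).trans_lt ht
  set a := H.form x y with ha
  have h0 : 0 ≤ H.form (H.smul a x - (t : ℂ) • y) (H.smul a x - (t : ℂ) • y) :=
    H.form_self_nonneg _
  have hs : a * H.form x x * star a ≤ t • (a * star a) := by
    refine (CStarAlgebra.star_right_conjugate_le_norm_smul
      (IsSelfAdjoint.of_nonneg (H.form_self_nonneg x))).trans ?_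
    exact smul_le_smul_of_nonneg_right ht.le (mul_star_self_nonneg a)
  have hya : H.form y x = star a := by rw [ha, H.star_form]
  have h1 : H.form (H.smul a x - (t : ℂ) • y) (H.smul a x - (t : ℂ) • y)
      = a * H.form x x * star a - t • (a * star a) - t • (a * star a) + t • (t • H.form y y) := by
    simp only [map_sub, map_smul, H.form_sub_left, H.form_smul, H.form_smul_left,
      H.form_complex_smul_left, hya, ← ha, Complex.star_def, Complex.conj_ofReal]
    simp only [Complex.coe_smul, smul_sub, sub_mul, mul_assoc, smul_mul_assoc]
    abel
  rw [h1] at h0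
  have h2 : t • (a * star a) ≤ t • (t • H.form y y) := by
    have h3 : 0 ≤ t • (t • H.form y y) - t • (a * star a) := by
      refine h0.trans ?_
      have := sub_le_sub_right hs (t • (a * star a))
      rw [sub_self] at this
      calc _ ≤ 0 - t • (a * star a) + t • (t • H.form y y) := by gcongr
        _ = _ := by abel
    exact sub_nonneg.1 h3
  rw [hya]
  exact (smul_le_smul_iff_of_pos_left ht0).1 h2

theorem norm_form_sq_le (x y : W) : ‖H.form x y‖ ^ 2 ≤ ‖H.form x x‖ * ‖H.form y y‖ := by
  refine le_of_forall_gt_imp_ge_of_dense fun r hr => ?_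
  by_cases hy : ‖H.form y y‖ = 0
  · have h := H.form_mul_form_swap_le x y (lt_add_one ‖H.form x x‖)
    rw [norm_eq_zero.1 hy, smul_zero, ← H.star_form x y] at h
    have h' : H.form x y * star (H.form x y) = 0 := le_antisymm h (mul_star_self_nonneg _)
    rw [(CStarRing.mul_star_self_eq_zero_iff _).1 h']
    rw [hy, mul_zero] at hr
    simpa using hr.le
  · have hy' : 0 < ‖H.form y y‖ := lt_of_le_of_ne (norm_nonneg _) (Ne.symm hy)
    -- Here `t = r / ‖⟨y, y⟩‖`, so that the norm of the right-hand side is exactly `r`.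
    have h := H.form_mul_form_swap_le x y ((lt_div_iff₀ hy').2 hr)
    have h1 := CStarAlgebra.norm_le_norm_of_nonneg_of_le
      (by rw [← H.star_form x y]; exact mul_star_self_nonneg _) h
    rw [← H.star_form x y, CStarRing.norm_self_mul_star, norm_smul, Real.norm_of_nonneg
      (div_nonneg ((mul_nonneg (norm_nonneg _) (norm_nonneg _)).trans hr.le) hy'.le),
      div_mul_cancel₀ _ hy, ← sq] at h1
    exact h1

theorem norm_form_le (x y : W) : ‖H.form x y‖ ≤ √‖H.form x x‖ * √‖H.form y y‖ := by
  rw [← Real.sqrt_mul (norm_nonneg _)]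
  exact Real.le_sqrt_of_sq_le (H.norm_form_sq_le x y)

set_option linter.unusedVariables false in
/-- The space `W` with the seminorm of the form. -/
@[nolint unusedArguments]
def Space (H : PreHilbertModule C W) : Type _ := W

instance : AddCommGroup H.Space := inferInstanceAs (AddCommGroup W)
instance : Module ℂ H.Space := inferInstanceAs (Module ℂ W)

/-- The identity map from `W` to its seminormed copy. -/
def toSpace : W ≃ₗ[ℂ] H.Space := LinearEquiv.refl ℂ W

noncomputable instance : Norm H.Space := ⟨fun x => √‖H.form (H.toSpace.symm x) (H.toSpace.symm x)‖⟩

omit [StarOrderedRing C] in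
theorem norm_toSpace (x : W) : ‖H.toSpace x‖ = √‖H.form x x‖ := rfl

theorem seminormedSpaceCore : SeminormedSpace.Core ℂ H.Space where
  norm_nonneg _ := Real.sqrt_nonneg _
  norm_smul c := H.toSpace.surjective.forall.2 fun x => by
    rw [← map_smul, norm_toSpace, norm_toSpace, map_smul, H.form_complex_smul_left, smul_smul,
      norm_smul, Real.sqrt_mul (norm_nonneg _)]
    simp
  norm_triangle := H.toSpace.surjective.forall.2 fun x => H.toSpace.surjective.forall.2 fun y => by
    rw [← map_add, norm_toSpace, norm_toSpace, norm_toSpace]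
    refine Real.sqrt_le_iff.2 ⟨by positivity, ?_⟩
    have h1 := H.norm_form_le x y
    have h2 := H.norm_form_le y x
    have h3 : ‖H.form (x + y) (x + y)‖ ≤
        ‖H.form x x‖ + ‖H.form x y‖ + ‖H.form y x‖ + ‖H.form y y‖ := by
      rw [map_add, H.form_add_left, H.form_add_left]
      refine (norm_add_le _ _).trans ?_
      linarith [norm_add_le (H.form x x) (H.form y x), norm_add_le (H.form x y) (H.form y y)]
    nlinarith [Real.sq_sqrt (norm_nonneg (H.form x x)), Real.sq_sqrt (norm_nonneg (H.form y y))]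

noncomputable instance : SeminormedAddCommGroup H.Space :=
  SeminormedAddCommGroup.ofCore H.seminormedSpaceCore

noncomputable instance : NormedSpace ℂ H.Space where
  norm_smul_le c x := (H.seminormedSpaceCore.norm_smul c x).le

omit [StarOrderedRing C] in
theorem norm_smul_le (c : C) (x : W) : ‖H.toSpace (H.smul c x)‖ ≤ ‖c‖ * ‖H.toSpace x‖ := by
  rw [norm_toSpace, norm_toSpace]
  refine Real.sqrt_le_iff.2 ⟨by positivity, ?_⟩
  rw [mul_pow, Real.sq_sqrt (norm_nonneg _), H.form_smul, H.form_smul_left]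
  refine (norm_mul_le _ _).trans ?_
  have := norm_mul_le (H.form x x) (star c)
  rw [norm_star] at this
  nlinarith [norm_nonneg c]

/-! ### The completion as a Hilbert module -/

/-- The completion of a semi-inner product module. -/
abbrev Completion : Type _ := UniformSpace.Completion H.Space

/-- The canonical map from a semi-inner product module to its completion. -/
noncomputable def toCompl : W →ₗ[ℂ] H.Completion :=
  (UniformSpace.Completion.toComplₗᵢ (𝕜 := ℂ) (E := H.Space)).toLinearMap.comp H.toSpace.toLinearMap

theorem denseRange_toCompl : DenseRange H.toCompl :=
  UniformSpace.Completion.denseRange_coe.comp H.toSpace.surjective.denseRange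
    (UniformSpace.Completion.continuous_coe _)

theorem norm_toCompl (x : W) : ‖H.toCompl x‖ = √‖H.form x x‖ :=
  UniformSpace.Completion.norm_coe (H.toSpace x)

@[elab_as_elim]
theorem toCompl_induction {p : H.Completion → Prop} (hp : IsClosed {x | p x})
    (h : ∀ x, p (H.toCompl x)) (x : H.Completion) : p x :=
  H.denseRange_toCompl.induction_on x hp h

/-- A linear map on `W` that is bounded for the seminorm, extended to the completion. -/
noncomputable def lift {X : Type*} [NormedAddCommGroup X] [NormedSpace ℂ X] [CompleteSpace X]
    (f : W →ₗ[ℂ] X) : H.Completion →L[ℂ] X := f.extendOfNorm H.toCompl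

/-- `lift` itself asks for no bound; this formula is where boundedness of `f` has to be supplied. -/
theorem lift_toCompl {X : Type*} [NormedAddCommGroup X] [NormedSpace ℂ X] [CompleteSpace X]
    {f : W →ₗ[ℂ] X} (c : ℝ) (h : ∀ x, ‖f x‖ ≤ c * ‖H.toCompl x‖) (x : W) :
    H.lift f (H.toCompl x) = f x :=
  LinearMap.extendOfNorm_eq H.denseRange_toCompl ⟨c, h⟩ x

noncomputable instance : SMul C H.Completion := ⟨fun c => H.lift (H.toCompl.comp (H.smul c))⟩

theorem smul_toCompl (c : C) (x : W) : c • H.toCompl x = H.toCompl (H.smul c x) :=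
  H.lift_toCompl ‖c‖ (fun x => by
    simpa only [LinearMap.comp_apply, norm_toCompl, norm_toSpace] using H.norm_smul_le c x) x

theorem continuous_smul_left (c : C) : Continuous fun x : H.Completion => c • x :=
  (H.lift (H.toCompl.comp (H.smul c))).continuous

/-- The continuous linear functional `y ↦ ⟨x, y⟩` on the completion. -/
noncomputable def innerRight (x : W) : H.Completion →L[ℂ] C := H.lift (H.form x)

theorem innerRight_toCompl (x y : W) : H.innerRight x (H.toCompl y) = H.form x y :=
  H.lift_toCompl ‖H.toCompl x‖ (fun y => by simpa only [norm_toCompl] using H.norm_form_le x y) y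

theorem norm_innerRight_le (x : W) (y : H.Completion) :
    ‖H.innerRight x y‖ ≤ ‖H.toCompl x‖ * ‖y‖ := by
  refine H.toCompl_induction ?_ (fun y => ?_) y
  · exact isClosed_le (by fun_prop) (by fun_prop)
  rw [innerRight_toCompl]
  simpa only [norm_toCompl] using H.norm_form_le x y

/-- `x ↦ ⟨y, x⟩*` for `y` in the completion. -/
noncomputable def innerLeft (y : H.Completion) : W →ₗ[ℂ] C where
  toFun x := star (H.innerRight x y)
  map_add' x x' := by
    rw [← star_add]
    congr 1
    refine H.toCompl_induction ?_ (fun y => ?_) y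
    · exact isClosed_eq (by fun_prop) (by fun_prop)
    simp only [innerRight_toCompl, form_add_left]
  map_smul' c x := by
    rw [RingHom.id_apply, ← star_star c, ← star_smul]
    congr 1
    refine H.toCompl_induction ?_ (fun y => ?_) y
    · exact isClosed_eq (by fun_prop) (by fun_prop)
    simp only [innerRight_toCompl, form_complex_smul_left, star_star]

/-- The extension of the form to the completion. -/
@[reducible] noncomputable def innerCompletion : Inner C H.Completion :=
  ⟨fun x y => H.lift (H.innerLeft x) y⟩

attribute [local instance] innerCompletion

/-- The form is extended one variable at a time, with a `star` in between. The second extension is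
legitimate because `innerRight` satisfies the Cauchy-Schwarz bound on the whole completion. -/
theorem inner_toCompl_right (x : H.Completion) (y : W) :
    inner C x (H.toCompl y) = star (H.innerRight y x) :=
  H.lift_toCompl ‖x‖ (fun y => by
    change ‖star (H.innerRight y x)‖ ≤ _
    rw [norm_star, mul_comm]
    exact H.norm_innerRight_le y x) y

theorem inner_toCompl_toCompl (x y : W) : inner C (H.toCompl x) (H.toCompl y) = H.form x y := by
  rw [inner_toCompl_right, innerRight_toCompl, H.star_form]

theorem continuous_inner_right (x : H.Completion) :
    Continuous fun y : H.Completion => inner C x y := (H.lift (H.innerLeft x)).continuous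

theorem norm_inner_le (x y : H.Completion) : ‖inner C x y‖ ≤ ‖x‖ * ‖y‖ := by
  refine H.toCompl_induction ?_ (fun y => ?_) y
  · exact isClosed_le (H.continuous_inner_right x).norm (by fun_prop)
  rw [inner_toCompl_right, norm_star, mul_comm]
  exact H.norm_innerRight_le y x

theorem star_inner_toCompl (x : H.Completion) (y : W) :
    star (inner C x (H.toCompl y)) = inner C (H.toCompl y) x := by
  rw [inner_toCompl_right, star_star]
  refine H.toCompl_induction ?_ (fun x => ?_) x
  · exact isClosed_eq (by fun_prop) (H.continuous_inner_right _)
  rw [innerRight_toCompl, inner_toCompl_toCompl]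

theorem inner_add_right' (x y z : H.Completion) :
    inner C x (y + z) = inner C x y + inner C x z := map_add (H.lift (H.innerLeft x)) y z

theorem inner_complex_smul_right' (c : ℂ) (x y : H.Completion) :
    inner C x (c • y) = c • inner C x y := map_smul (H.lift (H.innerLeft x)) c y

theorem inner_add_left' (x y z : H.Completion) :
    inner C (x + y) z = inner C x z + inner C y z := by
  refine H.toCompl_induction ?_ (fun z => ?_) z
  · exact isClosed_eq (H.continuous_inner_right _)
      ((H.continuous_inner_right _).add (H.continuous_inner_right _))
  simp only [inner_toCompl_right, map_add, star_add]

theorem inner_sub_left' (x y z : H.Completion) :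
    inner C (x - y) z = inner C x z - inner C y z := by
  rw [eq_sub_iff_add_eq, ← inner_add_left', sub_add_cancel]

/-- The extension is continuous in the second variable by construction; in the first it is Lipschitz
with constant `‖y‖` by Cauchy-Schwarz. -/
theorem continuous_inner_left (y : H.Completion) :
    Continuous fun x : H.Completion => inner C x y := by
  refine (LipschitzWith.of_dist_le_mul (K := ‖y‖₊) fun x x' => ?_).continuous
  rw [dist_eq_norm, dist_eq_norm, ← inner_sub_left', mul_comm, coe_nnnorm]
  exact H.norm_inner_le _ _

/-- Continuity along the diagonal transfers positivity and the norm formula from the dense image of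
`W`. It rests on `⟨x, x⟩ - ⟨x₀, x₀⟩ = ⟨x - x₀, x⟩ + ⟨x₀, x - x₀⟩`. -/
theorem continuous_inner_self : Continuous fun x : H.Completion => inner C x x := by
  refine continuous_iff_continuousAt.2 fun x₀ => tendsto_iff_norm_sub_tendsto_zero.2 ?_
  have h : Tendsto (fun x : H.Completion => ‖x - x₀‖ * ‖x‖ + ‖x₀‖ * ‖x - x₀‖) (𝓝 x₀) (𝓝 0) := by
    have : Continuous fun x : H.Completion => ‖x - x₀‖ * ‖x‖ + ‖x₀‖ * ‖x - x₀‖ := by fun_prop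
    simpa using this.tendsto x₀
  refine squeeze_zero (fun _ => norm_nonneg _) (fun x => ?_) h
  have h1 : inner C x x - inner C x₀ x₀ = inner C (x - x₀) x + inner C x₀ (x - x₀) := by
    have := H.inner_add_right' x₀ (x - x₀) x₀
    rw [sub_add_cancel] at this
    rw [inner_sub_left', this]
    abel
  rw [h1]
  exact (norm_add_le _ _).trans (add_le_add (H.norm_inner_le _ _) (H.norm_inner_le _ _))

theorem norm_eq_sqrt_norm_inner_self' (x : H.Completion) : ‖x‖ = √‖inner C x x‖ := by
  refine H.toCompl_induction ?_ (fun x => ?_) x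
  · exact isClosed_eq continuous_norm
      (Real.continuous_sqrt.comp H.continuous_inner_self.norm)
  rw [inner_toCompl_toCompl, norm_toCompl]

noncomputable instance : CStarModule C H.Completion where
  inner_add_right := H.inner_add_right' _ _ _
  inner_self_nonneg {x} := by
    refine H.toCompl_induction ?_ (fun x => ?_) x
    · exact isClosed_Ici.preimage H.continuous_inner_self
    change 0 ≤ inner C (H.toCompl x) (H.toCompl x)
    rw [inner_toCompl_toCompl]
    exact H.form_self_nonneg x
  inner_self {x} := by
    refine ⟨fun h => ?_, fun h => ?_⟩
    · rw [← norm_eq_zero, H.norm_eq_sqrt_norm_inner_self', h, norm_zero, Real.sqrt_zero]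
    · rw [h]
      exact map_zero (H.lift (H.innerLeft 0))
  inner_op_smul_right {c x y} := by
    refine H.toCompl_induction ?_ (fun y => ?_) y
    · exact isClosed_eq ((H.continuous_inner_right x).comp
        (H.continuous_smul_left c)) ((H.continuous_inner_right x).const_mul c)
    refine H.toCompl_induction ?_ (fun x => ?_) x
    · exact isClosed_eq (H.continuous_inner_left _)
        ((H.continuous_inner_left _).const_mul c)
    rw [smul_toCompl, inner_toCompl_toCompl, inner_toCompl_toCompl, H.form_smul]
  inner_smul_right_complex := H.inner_complex_smul_right' _ _ _
  star_inner x y := by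
    refine H.toCompl_induction ?_ (fun y => ?_) y
    · exact isClosed_eq (H.continuous_inner_right x).star
        (H.continuous_inner_left x)
    exact H.star_inner_toCompl x y
  norm_eq_sqrt_norm_inner_self := H.norm_eq_sqrt_norm_inner_self'

end PreHilbertModule

/-! ### A substitute for the unit in norm estimates -/

section Contraction

variable {A C : Type*} [NonUnitalCStarAlgebra A] [PartialOrder A] [StarOrderedRing A]
  [NonUnitalCStarAlgebra C] [PartialOrder C] [StarOrderedRing C]

/-- For a contraction `a`, `b = 1 - √(1 - a* a)` satisfies `(1 - b)² = 1 - a* a`. -/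
theorem exists_isSelfAdjoint_add_sub_mul_self {a : A} (ha : ‖a‖ ≤ 1) :
    ∃ b : A, star b = b ∧ b + b - b * b = star a * a := by
  set c := star a * a with hc
  have hc0 : 0 ≤ c := star_mul_self_nonneg a
  have hcs : IsSelfAdjoint c := IsSelfAdjoint.of_nonneg hc0
  have hc1 : ‖c‖ ≤ 1 := by
    rw [hc, CStarRing.norm_star_mul_self]
    nlinarith [norm_nonneg a]
  have hle : ∀ t ∈ quasispectrum ℝ c, t ≤ 1 := fun t ht =>
    (le_abs_self t).trans
      ((NonUnitalIsometricContinuousFunctionalCalculus.norm_quasispectrum_le c ht hcs).trans hc1)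
  let f : ℝ → ℝ := fun t => 1 - √(1 - t)
  have hf : Continuous f := by fun_prop
  -- Vanishing at `0` keeps `f(c)` inside `A` when there is no unit.
  have hf0 : f 0 = 0 := by simp [f]
  refine ⟨cfcₙ f c, (cfcₙ_predicate f c).star_eq, ?_⟩
  rw [← cfcₙ_add (f := f) (g := f) (a := c) hf.continuousOn hf0 hf.continuousOn hf0,
    ← cfcₙ_mul f f c hf.continuousOn hf0 hf.continuousOn hf0,
    ← cfcₙ_sub (f := fun t => f t + f t) (g := fun t => f t * f t) (a := c)
      (by fun_prop) (by simp [hf0]) (by fun_prop) (by simp [hf0])]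
  conv_rhs => rw [← cfcₙ_id ℝ c]
  refine cfcₙ_congr fun t ht => ?_
  have := Real.sq_sqrt (sub_nonneg.2 (hle t ht))
  simp only [f, id]
  linarith

/-- `X` plays the role of `f(1)` and `X - f(2b - b²)` that of `f((1 - b)²)`. After scaling `a` to
norm one, `1 - a* a` is such a square. With `f(a) = ⟨x, a x⟩` and `X = ⟨x, x⟩` the hypothesis reads
`⟨x - b x, x - b x⟩ ≥ 0`, and the conclusion is `⟨a x, a x⟩ ≤ ‖a‖² ⟨x, x⟩`. -/
theorem map_star_mul_self_le_of_forall_nonneg (f : A →ₗ[ℂ] C) (X : C)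
    (h : ∀ b, star b = b → 0 ≤ X - f (b + b - b * b)) (a : A) :
    f (star a * a) ≤ ‖a‖ ^ 2 • X := by
  rcases eq_or_ne a 0 with rfl | ha
  · simp
  have ha' : 0 < ‖a‖ := norm_pos_iff.2 ha
  obtain ⟨b, hb, hb'⟩ := exists_isSelfAdjoint_add_sub_mul_self (a := ((‖a‖ : ℂ)⁻¹) • a)
    (by rw [norm_smul]; simp [ha'.ne'])
  have h1 := h b hb
  rw [hb', star_smul, smul_mul_smul_comm, map_smul] at h1
  have h2 : (star ((‖a‖ : ℂ)⁻¹) * (‖a‖ : ℂ)⁻¹) • f (star a * a)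
      = (‖a‖ ^ 2)⁻¹ • f (star a * a) := by
    rw [← Complex.coe_smul]
    congr 1
    simp [sq]
  rw [h2, sub_nonneg] at h1
  have h3 := smul_le_smul_of_nonneg_left h1 (sq_nonneg ‖a‖)
  rwa [smul_smul, mul_inv_cancel₀ (by positivity), one_smul] at h3

end Contraction

/-! ### Calculus of the `B`-valued inner product -/

section RightInner

variable {B : Type*} [NonUnitalCStarAlgebra B] [PartialOrder B]
variable {E : Type*} [NormedAddCommGroup E] [NormedSpace ℂ E] [SMul Bᵐᵒᵖ E] [CStarModule Bᵐᵒᵖ E]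

theorem rightInner_add_right (x y z : E) :
    rightInner B x (y + z) = rightInner B x y + rightInner B x z := by simp [rightInner]

theorem rightInner_add_left (x y z : E) :
    rightInner B (x + y) z = rightInner B x z + rightInner B y z := by simp [rightInner]

theorem rightInner_sub_right (x y z : E) :
    rightInner B x (y - z) = rightInner B x y - rightInner B x z := by simp [rightInner]

theorem rightInner_sub_left (x y z : E) :
    rightInner B (x - y) z = rightInner B x z - rightInner B y z := by simp [rightInner]

theorem rightInner_smul_right (c : ℂ) (x y : E) :
    rightInner B x (c • y) = c • rightInner B x y := by simp [rightInner]

theorem rightInner_smul_left (c : ℂ) (x y : E) :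
    rightInner B (c • x) y = star c • rightInner B x y := by simp [rightInner]

theorem rightInner_sum_right {ι : Type*} (s : Finset ι) (x : E) (f : ι → E) :
    rightInner B x (∑ i ∈ s, f i) = ∑ i ∈ s, rightInner B x (f i) := by simp [rightInner]

theorem rightInner_sum_left {ι : Type*} (s : Finset ι) (f : ι → E) (x : E) :
    rightInner B (∑ i ∈ s, f i) x = ∑ i ∈ s, rightInner B (f i) x := by simp [rightInner]

variable (B) in
theorem norm_sq_eq_norm_rightInner (x : E) : ‖x‖ ^ 2 = ‖rightInner B x x‖ :=
  CStarModule.norm_sq_eq Bᵐᵒᵖ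

variable [StarOrderedRing B]

theorem norm_rightInner_le (x y : E) : ‖rightInner B x y‖ ≤ ‖x‖ * ‖y‖ :=
  CStarModule.norm_inner_le E (A := Bᵐᵒᵖ)

theorem Continuous.rightInner {X : Type*} [TopologicalSpace X] {f g : X → E} (hf : Continuous f)
    (hg : Continuous g) : Continuous fun t => rightInner B (f t) (g t) :=
  MulOpposite.continuous_unop.comp
    ((CStarModule.continuous_inner (A := Bᵐᵒᵖ) (E := E)).comp (hf.prodMk hg))

theorem Filter.Tendsto.rightInner {X : Type*} {l : Filter X} {f g : X → E} {x y : E}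
    (hf : Tendsto f l (𝓝 x)) (hg : Tendsto g l (𝓝 y)) :
    Tendsto (fun t => rightInner B (f t) (g t)) l (𝓝 (rightInner B x y)) :=
  ((Continuous.rightInner (B := B) continuous_fst continuous_snd).tendsto (x, y)).comp
    (hf.prodMk_nhds hg)

end RightInner

@[elab_as_elim]
theorem Dense.span_induction {E : Type*} [NormedAddCommGroup E] [NormedSpace ℂ E] {s : Set E}
    (hs : Dense (Submodule.span ℂ s : Set E)) {p : E → Prop} (hp : IsClosed {x | p x})
    (mem : ∀ x ∈ s, p x) (zero : p 0) (add : ∀ x y, p x → p y → p (x + y))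
    (smul : ∀ (c : ℂ) x, p x → p (c • x)) (x : E) : p x := by
  have h : (Submodule.span ℂ s : Set E) ⊆ {x | p x} := fun y hy =>
    Submodule.span_induction mem zero (fun _ _ _ _ => add _ _) (fun c _ _ => smul c _) hy
  exact closure_minimal h hp (hs x)

/-! ### Contractivity and nondegeneracy of the left action -/

namespace CStarCorrespondence

variable {A B : Type*} [NonUnitalCStarAlgebra A] [PartialOrder A] [StarOrderedRing A]
  [NonUnitalCStarAlgebra B] [PartialOrder B]
  (E : CStarCorrespondence A B)

omit [PartialOrder A] [StarOrderedRing A] in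
theorem leftAction_mul_apply (a b : A) (x : E) :
    E.leftAction (a * b) x = E.leftAction a (E.leftAction b x) := by
  rw [map_mul]; rfl

omit [PartialOrder A] [StarOrderedRing A] in
theorem rightInner_leftAction_right (a : A) (x y : E) :
    rightInner B x (E.leftAction a y) = rightInner B (E.leftAction (star a) x) y := by
  rw [map_star]
  exact (Adjointable.rightInner_adjoint_left (E.leftAction a) y x).symm

-- A vector killed by all of `A` is orthogonal to the dense span of `φ(A) E`. This allows `a` to be
-- cancelled when comparing `ζ` with `ζ'`.
omit [PartialOrder A] [StarOrderedRing A] in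
theorem eq_zero_of_forall_leftAction_eq_zero [StarOrderedRing B] {x : E}
    (h : ∀ a, E.leftAction a x = 0) : x = 0 := by
  refine rightInner_left_injective B fun y => ?_
  refine E.nondegenerate.span_induction ?_ ?_ ?_ ?_ ?_ y
  · exact isClosed_eq (continuous_id.rightInner continuous_const)
      (continuous_id.rightInner continuous_const)
  · rintro _ ⟨a, y, rfl⟩
    rw [← star_star a, ← rightInner_leftAction_right, h]
    simp [rightInner]
  · simp [rightInner]
  · intro y z hy hz
    rw [rightInner_add_left, rightInner_add_left, hy, hz]
  · intro c y hy
    rw [rightInner_smul_left, rightInner_smul_left, hy]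

variable [StarOrderedRing B]

theorem norm_leftAction_le (a : A) (x : E) : ‖E.leftAction a x‖ ≤ ‖a‖ * ‖x‖ := by
  have h := map_star_mul_self_le_of_forall_nonneg (C := B) (A := A)
    { toFun := fun a => rightInner B x (E.leftAction a x)
      map_add' := fun a b => by
        rw [map_add]; exact rightInner_add_right _ _ _
      map_smul' := fun c a => by
        rw [map_smul]; exact rightInner_smul_right _ _ _ } (rightInner B x x)
    (fun b hb => by
      have := rightInner_self_nonneg B (x - E.leftAction b x)
      have h2 : rightInner B x (E.leftAction (b * b) x)
          = rightInner B (E.leftAction b x) (E.leftAction b x) := by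
        rw [leftAction_mul_apply, rightInner_leftAction_right, hb]
      have h3 : rightInner B x (E.leftAction b x) = rightInner B (E.leftAction b x) x := by
        rw [rightInner_leftAction_right, hb]
      convert this using 1
      rw [LinearMap.map_sub, LinearMap.map_add]
      change rightInner B x x - (rightInner B x (E.leftAction b x)
        + rightInner B x (E.leftAction b x) - rightInner B x (E.leftAction (b * b) x)) = _
      simp only [rightInner_sub_left, rightInner_sub_right, h2, h3]
      abel) a
  change rightInner B x (E.leftAction (star a * a) x) ≤ _ at h
  rw [leftAction_mul_apply, rightInner_leftAction_right, star_star] at h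
  have h' := CStarAlgebra.norm_le_norm_of_nonneg_of_le (rightInner_self_nonneg B _) h
  rw [← norm_sq_eq_norm_rightInner, norm_smul, ← norm_sq_eq_norm_rightInner,
    Real.norm_of_nonneg (by positivity), ← mul_pow] at h'
  exact (sq_le_sq₀ (norm_nonneg _) (by positivity)).1 h'

/-- On vectors `a y` this is `e a → a`. Since `‖e‖ ≤ 1` eventually, the operators are uniformly
bounded, so the set of good vectors is closed, and nondegeneracy finishes. -/
theorem tendsto_leftAction {l : Filter A} (hl : l.IsIncreasingApproximateUnit) (x : E) :
    Tendsto (fun e => E.leftAction e x) l (𝓝 x) := by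
  refine E.nondegenerate.span_induction ?_ ?_ ?_ ?_ ?_ x
  · refine isClosed_of_closure_subset fun x hx => Metric.tendsto_nhds.2 fun ε hε => ?_
    obtain ⟨y, hy, hxy⟩ := Metric.mem_closure_iff.1 hx (ε / 3) (by positivity)
    filter_upwards [Metric.tendsto_nhds.1 hy (ε / 3) (by positivity), hl.eventually_norm]
      with e he he1
    have h1 : dist (E.leftAction e x) (E.leftAction e y) ≤ dist x y := by
      rw [dist_eq_norm, dist_eq_norm, ← map_sub]
      exact (E.norm_leftAction_le e _).trans (mul_le_of_le_one_left (norm_nonneg _) he1)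
    have h2 := dist_triangle4 (E.leftAction e x) (E.leftAction e y) y x
    rw [dist_comm y x] at h2
    linarith
  · rintro _ ⟨a, y, rfl⟩
    refine tendsto_iff_norm_sub_tendsto_zero.2 ?_
    have h := (tendsto_iff_norm_sub_tendsto_zero.1 (hl.tendsto_mul_right a)).mul_const ‖y‖
    rw [zero_mul] at h
    refine squeeze_zero (fun _ => norm_nonneg _) (fun e => ?_) h
    have h1 : E.leftAction e (E.leftAction a y) - E.leftAction a y
        = E.leftAction (e * a - a) y := by
      rw [map_sub, map_mul]
      rfl
    rw [h1]
    exact E.norm_leftAction_le _ _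
  · simpa using tendsto_const_nhds
  · intro y z hy hz
    simpa using hy.add hz
  · intro c y hy
    simpa using hy.const_smul c

end CStarCorrespondence

/-! ### Sesquilinear forms on finite formal combinations -/

section ScalarForm

variable {P C : Type*} [NonUnitalCStarAlgebra C]

/-- The sesquilinear form on `P →₀ ℂ` with matrix `K`. -/
noncomputable def matrixForm (K : P → P → C) (x : P →₀ ℂ) : (P →₀ ℂ) →ₗ[ℂ] C :=
  Finsupp.linearCombination ℂ fun q => x.sum fun p c => star c • K p q

theorem matrixForm_apply (K : P → P → C) (x y : P →₀ ℂ) : matrixForm K x y =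
    ∑ p ∈ x.support, ∑ q ∈ y.support, (star (x p) * y q) • K p q := by
  simp only [matrixForm, Finsupp.linearCombination_apply, Finsupp.sum, Finset.smul_sum, smul_smul]
  rw [Finset.sum_comm]
  simp only [mul_comm]

theorem matrixForm_single_single (K : P → P → C) (p q : P) :
    matrixForm K (Finsupp.single p 1) (Finsupp.single q 1) = K p q := by
  simp [matrixForm]

theorem matrixForm_add_left (K : P → P → C) (x x' y : P →₀ ℂ) :
    matrixForm K (x + x') y = matrixForm K x y + matrixForm K x' y := by
  classical
  rw [← LinearMap.add_apply]
  congr 1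
  refine Finsupp.lhom_ext' fun q => LinearMap.ext_ring ?_
  simp [matrixForm, Finsupp.sum_add_index, add_smul]

theorem matrixForm_smul_left (K : P → P → C) (c : ℂ) (x y : P →₀ ℂ) :
    matrixForm K (c • x) y = star c • matrixForm K x y := by
  rw [← LinearMap.smul_apply]
  congr 1
  refine Finsupp.lhom_ext' fun q => LinearMap.ext_ring ?_
  simp [matrixForm, Finsupp.sum_smul_index, Finsupp.smul_sum, smul_smul]

theorem matrixForm_mapDomain_right (K : P → P → C) (f : P → P) (x y : P →₀ ℂ) :
    matrixForm K x (Finsupp.mapDomain f y) = matrixForm (fun p q => K p (f q)) x y := by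
  simp [matrixForm, Finsupp.linearCombination_mapDomain, Function.comp_def]

theorem matrixForm_mapDomain_left (K : P → P → C) (f : P → P) (x y : P →₀ ℂ) :
    matrixForm K (Finsupp.mapDomain f x) y = matrixForm (fun p q => K (f p) q) x y := by
  congr 1
  refine Finsupp.lhom_ext' fun q => LinearMap.ext_ring ?_
  simp [matrixForm, Finsupp.sum_mapDomain_index, add_smul]

/-- Polarization: a sesquilinear form with self-adjoint diagonal is Hermitian. -/
theorem star_eq_swap_of_isSelfAdjoint_diagonal {W : Type*} [AddCommGroup W] [Module ℂ W]
    (g : W → W →ₗ[ℂ] C)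
    (add : ∀ x x' y, g (x + x') y = g x y + g x' y)
    (smul : ∀ (c : ℂ) x y, g (c • x) y = star c • g x y)
    (self : ∀ x, IsSelfAdjoint (g x x)) (x y : W) : star (g x y) = g y x := by
  have h1 := (self (x + y)).star_eq
  have h2 := (self (x + Complex.I • y)).star_eq
  have hx := (self x).star_eq
  have hy := (self y).star_eq
  simp only [add, smul, map_add, map_smul, star_add, star_smul, hx, hy, Complex.star_def,
    Complex.conj_I, neg_smul, star_neg] at h1 h2
  -- The diagonal at `x + y` gives the sums, the diagonal at `x + i y` the differences; subtracting
  -- the second identity from the first leaves twice the claim.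
  have h3 : star (g x y) + star (g y x) = g x y + g y x := by
    rw [← sub_eq_zero] at h1 ⊢
    rw [← h1]; abel
  have h4 : Complex.I • (star (g y x) - star (g x y)) = Complex.I • (g x y - g y x) := by
    rw [← sub_eq_zero] at h2 ⊢
    rw [← h2]
    simp only [smul_sub, smul_add, smul_neg, neg_neg]
    abel
  have h5 := smul_right_injective C Complex.I_ne_zero h4
  have h6 : (2 : ℂ) • star (g x y) = (2 : ℂ) • g y x := by
    rw [two_smul, two_smul]
    have : star (g y x) = g x y - g y x + star (g x y) := by
      rw [← sub_eq_iff_eq_add]; exact h5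
    rw [this] at h3
    rw [← sub_eq_zero] at h3 ⊢
    rw [← h3]; abel
  exact smul_right_injective C two_ne_zero h6

end ScalarForm

/-! ### Elementary vectors and their Gram form -/

/-- The index set of the elementary vectors `a ⊗ s ⊗ ξ`. -/
structure KernelIndex (A : Type u) (S : Type x) (F : Type w) : Type (max u w x y) where
  left : A
  point : S
  vec : F

namespace KernelIndex

variable {A : Type u} {S : Type x} {F : Type w} {B : Type v}
  [NonUnitalCStarAlgebra A] [NonUnitalCStarAlgebra B] [PartialOrder B]
  [NormedAddCommGroup F] [NormedSpace ℂ F] [SMul Bᵐᵒᵖ F] [CStarModule Bᵐᵒᵖ F]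

/-- Left multiplication on the algebra component. -/
def leftMul (a : A) (p : KernelIndex.{u, w, x, y} A S F) : KernelIndex.{u, w, x, y} A S F :=
  ⟨a * p.left, p.point, p.vec⟩

/-- The right action of `B` on the vector component. -/
def rightMul (b : Bᵐᵒᵖ) (p : KernelIndex.{u, w, x, y} A S F) : KernelIndex.{u, w, x, y} A S F :=
  ⟨p.left, p.point, b • p.vec⟩

/-- The matrix `⟨ξ, k(s,t)(a* b) η⟩` of inner products of elementary vectors. -/
noncomputable def gram (k : S → S → A →L[ℂ] Adjointable B F F)
    (p q : KernelIndex.{u, w, x, y} A S F) : Bᵐᵒᵖ :=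
  MulOpposite.op (rightInner B p.vec (k p.point q.point (star p.left * q.left) q.vec))

end KernelIndex

section Kernel

variable {A : Type u} {S : Type x} {F : Type w} {B : Type v}
  [NonUnitalCStarAlgebra A] [NonUnitalCStarAlgebra B] [PartialOrder B]
  [NormedAddCommGroup F] [NormedSpace ℂ F] [SMul Bᵐᵒᵖ F] [CStarModule Bᵐᵒᵖ F]

/-- Right `B`-linearity is forced by the adjoint: pair with `z` and move `T` across. -/
theorem Adjointable.map_op_smul (T : Adjointable B F F) (b : Bᵐᵒᵖ) (ξ : F) :
    T (b • ξ) = b • T ξ := by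
  refine rightInner_left_injective B fun z => ?_
  obtain ⟨b, rfl⟩ := MulOpposite.op_surjective b
  rw [← Adjointable.rightInner_adjoint_left, rightInner_op_smul_right, rightInner_op_smul_right,
    Adjointable.rightInner_adjoint_left]

variable {k : S → S → A →L[ℂ] Adjointable B F F}

theorem IsPositiveDefiniteKernel.sum_nonneg (hk : IsPositiveDefiniteKernel k) {ι : Type*}
    (I : Finset ι) (s : ι → S) (a : ι → A) (ξ : ι → F) :
    0 ≤ ∑ i ∈ I, ∑ j ∈ I, rightInner B (ξ i) (k (s i) (s j) (star (a i) * a j) (ξ j)) := by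
  let e := I.equivFin.symm
  have h := hk I.card (fun i => s (e i)) (fun i => a (e i)) (fun i => ξ (e i))
  rw [e.sum_comp (fun i : I => ∑ j, rightInner B (ξ i)
    (k (s i) (s (e j)) (star (a i) * a (e j)) (ξ (e j))))] at h
  simp_rw [fun i : I => e.sum_comp (fun j : I => rightInner B (ξ i)
    (k (s i) (s j) (star (a i) * a j) (ξ j)))] at h
  rw [← Finset.sum_coe_sort]
  simp_rw [← Finset.sum_coe_sort I (fun j => rightInner B (ξ _)
    (k (s _) (s j) (star (a _) * a j) (ξ j)))]
  exact h

theorem IsPositiveDefiniteKernel.matrixForm_self_nonneg (hk : IsPositiveDefiniteKernel k)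
    (f : KernelIndex.{u, w, x, y} A S F →₀ ℂ) :
    0 ≤ matrixForm (KernelIndex.gram k) f f := by
  -- The scalar coefficients are absorbed into the vectors of `F`.
  have h := hk.sum_nonneg f.support (fun p => p.point) (fun p => p.left) (fun p => f p • p.vec)
  rw [← MulOpposite.op_nonneg] at h
  convert h
  rw [matrixForm_apply, Finset.op_sum]
  refine Finset.sum_congr rfl fun p _ => ?_
  rw [Finset.op_sum]
  refine Finset.sum_congr rfl fun q _ => ?_
  rw [map_smul, rightInner_smul_left, rightInner_smul_right, smul_smul, MulOpposite.op_smul]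
  rfl

/-- The semi-inner product module spanned by the elementary vectors of a positive-definite
kernel. -/
noncomputable def IsPositiveDefiniteKernel.preHilbertModule [StarOrderedRing B]
    (hk : IsPositiveDefiniteKernel k) :
    PreHilbertModule Bᵐᵒᵖ (KernelIndex.{u, w, x, y} A S F →₀ ℂ) where
  form := matrixForm (KernelIndex.gram k)
  smul b := Finsupp.lmapDomain ℂ ℂ (KernelIndex.rightMul b)
  -- Hermitian symmetry of `k` is not part of positive-definiteness; it comes by polarization from
  -- the positive diagonal.
  star_form := star_eq_swap_of_isSelfAdjoint_diagonal _ (matrixForm_add_left _)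
    (matrixForm_smul_left _) fun f => .of_nonneg (hk.matrixForm_self_nonneg f)
  form_self_nonneg := hk.matrixForm_self_nonneg
  form_smul b f g := by
    obtain ⟨b, rfl⟩ := MulOpposite.op_surjective b
    rw [Finsupp.lmapDomain_apply, matrixForm_mapDomain_right, matrixForm_apply, matrixForm_apply,
      Finset.mul_sum]
    refine Finset.sum_congr rfl fun p _ => ?_
    rw [Finset.mul_sum]
    refine Finset.sum_congr rfl fun q _ => ?_
    rw [mul_smul_comm]
    congr 1
    simp only [KernelIndex.gram, KernelIndex.rightMul, Adjointable.map_op_smul,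
      rightInner_op_smul_right, MulOpposite.op_mul]

end Kernel

/-- Writing `e = c* c` gives `e² = c* (c c*) c ≤ ‖c c*‖ c* c`, with no unit involved. -/
theorem mul_self_le_self_of_nonneg_of_norm_le_one {A : Type*} [NonUnitalCStarAlgebra A]
    [PartialOrder A] [StarOrderedRing A] {e : A} (h0 : 0 ≤ e) (h1 : ‖e‖ ≤ 1) : e * e ≤ e := by
  obtain ⟨c, rfl⟩ := CStarAlgebra.nonneg_iff_eq_star_mul_self.1 h0
  have h2 : ‖c * star c‖ ≤ 1 := by
    rwa [CStarRing.norm_self_mul_star, ← CStarRing.norm_star_mul_self]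
  have h := CStarAlgebra.star_left_conjugate_le_norm_smul (a := c)
    (IsSelfAdjoint.of_nonneg (mul_star_self_nonneg c))
  have h3 : star c * c * (star c * c) = star c * (c * star c) * c := by simp only [mul_assoc]
  rw [h3]
  refine h.trans ?_
  have := smul_le_smul_of_nonneg_right h2 (star_mul_self_nonneg c)
  rwa [one_smul] at this

/-! ### The completion of the elementary vectors and the action of `A` -/

namespace IsPositiveDefiniteKernel

variable {A : Type u} {S : Type x} {F : Type w} {B : Type v}
  [NonUnitalCStarAlgebra A] [NonUnitalCStarAlgebra B] [PartialOrder B]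
  [NormedAddCommGroup F] [NormedSpace ℂ F] [SMul Bᵐᵒᵖ F] [CStarModule Bᵐᵒᵖ F]
  {k : S → S → A →L[ℂ] Adjointable B F F}

/-- Left multiplication on finite combinations of elementary vectors. -/
noncomputable def leftMul (a : A) : (KernelIndex.{u, w, x, y} A S F →₀ ℂ) →ₗ[ℂ]
    (KernelIndex.{u, w, x, y} A S F →₀ ℂ) := Finsupp.lmapDomain ℂ ℂ (KernelIndex.leftMul a)

omit [NormedAddCommGroup F] [NormedSpace ℂ F] in
theorem leftMul_mul (a b : A) (f : KernelIndex.{u, w, x, y} A S F →₀ ℂ) :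
    leftMul (a * b) f = leftMul a (leftMul b f) := by
  simp only [leftMul, Finsupp.lmapDomain_apply, ← Finsupp.mapDomain_comp]
  congr 1
  ext p
  simp [KernelIndex.leftMul, mul_assoc]

variable (k) in
/-- The kernel with values in the bounded operators. -/
noncomputable def kernelCLM (s t : S) : A →L[ℂ] F →L[ℂ] F :=
  (adjointableSubmodule B F F).subtypeL.comp (k s t)

theorem tendsto_kernelCLM {X : Type*} {l : Filter X} {f : X → A} {a : A}
    (s t : S) (ξ : F) (hf : Tendsto f l (𝓝 a)) :
    Tendsto (fun e => kernelCLM k s t (f e) ξ) l (𝓝 (kernelCLM k s t a ξ)) :=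
  (((ContinuousLinearMap.apply ℂ F ξ).comp (kernelCLM k s t)).continuous.tendsto a).comp hf

variable [StarOrderedRing B] (hk : IsPositiveDefiniteKernel k)
include hk

theorem form_leftMul_right (a : A) (f g : KernelIndex.{u, w, x, y} A S F →₀ ℂ) :
    hk.preHilbertModule.form f (leftMul a g) =
      hk.preHilbertModule.form (leftMul (star a) f) g := by
  simp only [preHilbertModule, leftMul, Finsupp.lmapDomain_apply, matrixForm_mapDomain_right,
    matrixForm_mapDomain_left]
  congr 2
  ext p q
  simp [KernelIndex.gram, KernelIndex.leftMul, mul_assoc]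

/-- The map `a ↦ ⟨f, a g⟩`. -/
noncomputable def coefficient (f g : KernelIndex.{u, w, x, y} A S F →₀ ℂ) : A →ₗ[ℂ] Bᵐᵒᵖ where
  toFun a := hk.preHilbertModule.form f (leftMul a g)
  map_add' a b := by
    simp only [preHilbertModule, leftMul, Finsupp.lmapDomain_apply, matrixForm_mapDomain_right]
    simp only [matrixForm_apply, ← Finset.sum_add_distrib, ← smul_add]
    refine Finset.sum_congr rfl fun p _ => Finset.sum_congr rfl fun q _ => ?_
    congr 1
    simp only [KernelIndex.gram, KernelIndex.leftMul, ← MulOpposite.op_add]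
    rw [← rightInner_add_right, add_mul, mul_add, map_add]
    rfl
  map_smul' c a := by
    simp only [preHilbertModule, leftMul, Finsupp.lmapDomain_apply, matrixForm_mapDomain_right]
    simp only [matrixForm_apply, Finset.smul_sum, RingHom.id_apply]
    refine Finset.sum_congr rfl fun p _ => Finset.sum_congr rfl fun q _ => ?_
    rw [smul_comm]
    congr 1
    simp only [KernelIndex.gram, KernelIndex.leftMul, ← MulOpposite.op_smul]
    rw [← rightInner_smul_right, smul_mul_assoc, mul_smul_comm, map_smul]
    rfl

variable [PartialOrder A] [StarOrderedRing A]

/-- For self-adjoint `b`, `⟨f, f⟩ - ⟨f, (2b - b²) f⟩ = ⟨f - b f, f - b f⟩ ≥ 0`, so the unit-free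
estimate applies to `a ↦ ⟨f, a f⟩`. This makes the action extend to the completion. -/
theorem norm_toCompl_leftMul_le (a : A) (f : KernelIndex.{u, w, x, y} A S F →₀ ℂ) :
    ‖hk.preHilbertModule.toCompl (leftMul a f)‖ ≤ ‖a‖ * ‖hk.preHilbertModule.toCompl f‖ := by
  have h := map_star_mul_self_le_of_forall_nonneg (hk.coefficient f f)
    (hk.preHilbertModule.form f f) (fun b hb => by
      convert hk.preHilbertModule.form_self_nonneg (f - leftMul b f) using 1
      have h1 : hk.preHilbertModule.form f (leftMul b f) =
        hk.preHilbertModule.form (leftMul b f) f := by rw [form_leftMul_right, hb]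
      have h2 : hk.preHilbertModule.form f (leftMul (b * b) f) =
        hk.preHilbertModule.form (leftMul b f) (leftMul b f) := by
        rw [leftMul_mul, form_leftMul_right, hb]
      rw [map_sub, map_add]
      simp only [coefficient, LinearMap.coe_mk, AddHom.coe_mk]
      rw [map_sub, PreHilbertModule.form_sub_left, PreHilbertModule.form_sub_left, h1, h2]
      abel) a
  simp only [coefficient, LinearMap.coe_mk, AddHom.coe_mk] at h
  rw [leftMul_mul, form_leftMul_right, star_star] at h
  have h' := CStarAlgebra.norm_le_norm_of_nonneg_of_le (hk.preHilbertModule.form_self_nonneg _) h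
  rw [norm_smul, Real.norm_of_nonneg (by positivity)] at h'
  rw [PreHilbertModule.norm_toCompl, PreHilbertModule.norm_toCompl]
  refine Real.sqrt_le_iff.2 ⟨by positivity, ?_⟩
  rwa [mul_pow, Real.sq_sqrt (norm_nonneg _)]

/-- The action of `a` on the completion. -/
noncomputable def leftActionCLM (a : A) :
    (preHilbertModule.{u, v, w, x, y} hk).Completion →L[ℂ]
      (preHilbertModule.{u, v, w, x, y} hk).Completion :=
  hk.preHilbertModule.lift (hk.preHilbertModule.toCompl.comp (leftMul a))

theorem leftActionCLM_toCompl (a : A) (f : KernelIndex.{u, w, x, y} A S F →₀ ℂ) :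
    hk.leftActionCLM a (hk.preHilbertModule.toCompl f) =
      hk.preHilbertModule.toCompl (leftMul a f) :=
  hk.preHilbertModule.lift_toCompl ‖a‖ (hk.norm_toCompl_leftMul_le a) f

omit [PartialOrder A] [StarOrderedRing A] in
theorem rightInner_toCompl (f g : KernelIndex.{u, w, x, y} A S F →₀ ℂ) :
    rightInner B (hk.preHilbertModule.toCompl f) (hk.preHilbertModule.toCompl g) =
      (hk.preHilbertModule.form f g).unop :=
  congrArg MulOpposite.unop (hk.preHilbertModule.inner_toCompl_toCompl f g)

/-- The elementary vector `a ⊗ s ⊗ ξ` of the completion. -/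
noncomputable def elem (a : A) (s : S) (ξ : F) :
    (preHilbertModule.{u, v, w, x, y} hk).Completion :=
  hk.preHilbertModule.toCompl (Finsupp.single ⟨a, s, ξ⟩ 1)

omit [PartialOrder A] [StarOrderedRing A] in
theorem rightInner_elem_elem (a b : A) (s t : S) (ξ η : F) :
    rightInner B (elem.{u, v, w, x, y} hk a s ξ) (hk.elem b t η) =
      rightInner B ξ (k s t (star a * b) η) := by
  rw [elem, elem, rightInner_toCompl, preHilbertModule, matrixForm_single_single]
  rfl

omit [PartialOrder A] [StarOrderedRing A] in
theorem dense_span_elem : Dense (Submodule.span ℂ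
    {z | ∃ (a : A) (s : S) (ξ : F), z = elem.{u, v, w, x, y} hk a s ξ} :
      Set (preHilbertModule.{u, v, w, x, y} hk).Completion) := by
  refine hk.preHilbertModule.denseRange_toCompl.mono ?_
  rintro _ ⟨f, rfl⟩
  induction f using Finsupp.induction_linear with
  | zero => rw [map_zero]; exact zero_mem _
  | add f g hf hg => rw [map_add]; exact add_mem hf hg
  | single p c =>
    rw [← mul_one c, ← smul_eq_mul, ← Finsupp.smul_single, map_smul]
    exact Submodule.smul_mem _ _ (Submodule.subset_span ⟨p.left, p.point, p.vec, rfl⟩)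

omit [PartialOrder A] [StarOrderedRing A] in
theorem eq_of_forall_rightInner_elem {z z' : (preHilbertModule.{u, v, w, x, y} hk).Completion}
    (h : ∀ a s ξ, rightInner B (hk.elem a s ξ) z = rightInner B (hk.elem a s ξ) z') : z = z' := by
  refine rightInner_left_injective B fun t => ?_
  refine hk.dense_span_elem.span_induction ?_ ?_ ?_ ?_ ?_ t
  · exact isClosed_eq (continuous_id.rightInner continuous_const)
      (continuous_id.rightInner continuous_const)
  · rintro _ ⟨a, s, ξ, rfl⟩
    exact h a s ξ
  · simp [rightInner]
  · intro y z hy hz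
    rw [rightInner_add_left, rightInner_add_left, hy, hz]
  · intro c y hy
    rw [rightInner_smul_left, rightInner_smul_left, hy]

omit [PartialOrder A] [StarOrderedRing A] in
theorem clm_ext_elem {X : Type*} [NormedAddCommGroup X] [NormedSpace ℂ X]
    {T R : (preHilbertModule.{u, v, w, x, y} hk).Completion →L[ℂ] X}
    (h : ∀ a s ξ, T (hk.elem a s ξ) = R (hk.elem a s ξ)) : T = R := by
  refine ContinuousLinearMap.ext_on hk.dense_span_elem ?_
  rintro _ ⟨a, s, ξ, rfl⟩
  exact h a s ξ

theorem leftActionCLM_elem (a b : A) (s : S) (ξ : F) :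
    hk.leftActionCLM a (elem.{u, v, w, x, y} hk b s ξ) = hk.elem (a * b) s ξ := by
  rw [elem, leftActionCLM_toCompl, leftMul, Finsupp.lmapDomain_apply, Finsupp.mapDomain_single]
  rfl

theorem rightInner_leftActionCLM (a : A)
    (z z' : (preHilbertModule.{u, v, w, x, y} hk).Completion) :
    rightInner B (hk.leftActionCLM a z) z' = rightInner B z (hk.leftActionCLM (star a) z') := by
  refine hk.preHilbertModule.toCompl_induction ?_ (fun f => ?_) z
  · exact isClosed_eq ((hk.leftActionCLM a).continuous.rightInner continuous_const)
      (continuous_id.rightInner continuous_const)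
  refine hk.preHilbertModule.toCompl_induction ?_ (fun g => ?_) z'
  · exact isClosed_eq (continuous_const.rightInner continuous_id)
      (continuous_const.rightInner (hk.leftActionCLM _).continuous)
  rw [leftActionCLM_toCompl, leftActionCLM_toCompl, rightInner_toCompl, rightInner_toCompl,
    form_leftMul_right, star_star]

-- The free generators satisfy no linear relations. These appear only in the completion, where
-- vectors with equal inner products against all elementary vectors coincide.
omit [PartialOrder A] [StarOrderedRing A] in
theorem elem_add_left (a b : A) (s : S) (ξ : F) :
    elem.{u, v, w, x, y} hk (a + b) s ξ = hk.elem a s ξ + hk.elem b s ξ := by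
  refine hk.eq_of_forall_rightInner_elem fun c t η => ?_
  rw [rightInner_add_right, rightInner_elem_elem, rightInner_elem_elem, rightInner_elem_elem,
    mul_add, map_add]
  exact rightInner_add_right _ _ _

omit [PartialOrder A] [StarOrderedRing A] in
theorem elem_smul_left (c : ℂ) (a : A) (s : S) (ξ : F) :
    elem.{u, v, w, x, y} hk (c • a) s ξ = c • hk.elem a s ξ := by
  refine hk.eq_of_forall_rightInner_elem fun b t η => ?_
  rw [rightInner_smul_right, rightInner_elem_elem, rightInner_elem_elem, mul_smul_comm, map_smul]
  exact rightInner_smul_right _ _ _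

omit [PartialOrder A] [StarOrderedRing A] in
theorem elem_add_right (a : A) (s : S) (ξ η : F) :
    elem.{u, v, w, x, y} hk a s (ξ + η) = hk.elem a s ξ + hk.elem a s η := by
  refine hk.eq_of_forall_rightInner_elem fun c t ζ => ?_
  rw [rightInner_add_right, rightInner_elem_elem, rightInner_elem_elem, rightInner_elem_elem,
    map_add, rightInner_add_right]

omit [PartialOrder A] [StarOrderedRing A] in
theorem elem_smul_right (c : ℂ) (a : A) (s : S) (ξ : F) :
    elem.{u, v, w, x, y} hk a s (c • ξ) = c • hk.elem a s ξ := by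
  refine hk.eq_of_forall_rightInner_elem fun b t η => ?_
  rw [rightInner_smul_right, rightInner_elem_elem, rightInner_elem_elem, map_smul,
    rightInner_smul_right]

omit [PartialOrder A] [StarOrderedRing A] in
theorem norm_elem_le (a : A) (s : S) (ξ : F) :
    ‖elem.{u, v, w, x, y} hk a s ξ‖ ≤ √‖kernelCLM k s s‖ * ‖a‖ * ‖ξ‖ := by
  have h : ‖elem.{u, v, w, x, y} hk a s ξ‖ ^ 2 ≤ (√‖kernelCLM k s s‖ * ‖a‖ * ‖ξ‖) ^ 2 := by
    rw [norm_sq_eq_norm_rightInner B, rightInner_elem_elem, mul_pow, mul_pow,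
      Real.sq_sqrt (norm_nonneg (kernelCLM k s s))]
    calc _ ≤ ‖ξ‖ * ‖k s s (star a * a) ξ‖ := norm_rightInner_le _ _
      _ ≤ ‖ξ‖ * (‖kernelCLM k s s‖ * ‖star a * a‖ * ‖ξ‖) := by
        gcongr
        exact (kernelCLM k s s).le_opNorm₂ (star a * a) ξ
      _ = _ := by rw [CStarRing.norm_star_mul_self]; ring
  exact (sq_le_sq₀ (norm_nonneg _) (by positivity)).1 h

/-- The left action of `A` on the completion by adjointable operators. -/
noncomputable def leftAction : A →⋆ₙₐ[ℂ] Adjointable B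
    (preHilbertModule.{u, v, w, x, y} hk).Completion
    (preHilbertModule.{u, v, w, x, y} hk).Completion where
  toFun a := ⟨hk.leftActionCLM a, hk.leftActionCLM (star a), hk.rightInner_leftActionCLM a⟩
  map_smul' c a := Subtype.ext <| hk.clm_ext_elem fun b s ξ => by
    change hk.leftActionCLM (c • a) _ = c • hk.leftActionCLM a _
    simp only [leftActionCLM_elem, smul_mul_assoc, elem_smul_left]
  map_zero' := Subtype.ext <| hk.clm_ext_elem fun b s ξ => by
    change hk.leftActionCLM 0 _ = 0
    rw [leftActionCLM_elem, zero_mul, ← zero_smul ℂ (0 : A), elem_smul_left, zero_smul]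
  map_add' a a' := Subtype.ext <| hk.clm_ext_elem fun b s ξ => by
    change hk.leftActionCLM (a + a') _ = hk.leftActionCLM a _ + hk.leftActionCLM a' _
    simp only [leftActionCLM_elem, add_mul, elem_add_left]
  map_mul' a a' := Subtype.ext <| hk.clm_ext_elem fun b s ξ => by
    change hk.leftActionCLM (a * a') _ = hk.leftActionCLM a (hk.leftActionCLM a' _)
    simp only [leftActionCLM_elem, mul_assoc]
  map_star' a := Adjointable.eq_adjoint fun z z' => (hk.rightInner_leftActionCLM a z z').symm

theorem leftAction_elem (a b : A) (s : S) (ξ : F) :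
    hk.leftAction a (elem.{u, v, w, x, y} hk b s ξ) = hk.elem (a * b) s ξ :=
  hk.leftActionCLM_elem a b s ξ

end IsPositiveDefiniteKernel

/-! ### The operators `ζ(s)` as limits along an approximate unit -/

namespace IsPositiveDefiniteKernel

variable {A : Type u} {S : Type x} {F : Type w} {B : Type v}
  [NonUnitalCStarAlgebra A] [PartialOrder A] [StarOrderedRing A]
  [NonUnitalCStarAlgebra B] [PartialOrder B] [StarOrderedRing B]
  [NormedAddCommGroup F] [NormedSpace ℂ F] [SMul Bᵐᵒᵖ F] [CStarModule Bᵐᵒᵖ F]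
  {k : S → S → A →L[ℂ] Adjointable B F F} (hk : IsPositiveDefiniteKernel k)
include hk

omit [StarOrderedRing B] in
theorem rightInner_nonneg_of_nonneg (s : S) {a : A} (ha : 0 ≤ a) (ξ : F) :
    0 ≤ rightInner B ξ (k s s a ξ) := by
  obtain ⟨c, rfl⟩ := CStarAlgebra.nonneg_iff_eq_star_mul_self.1 ha
  simpa using hk 1 (fun _ => s) (fun _ => c) (fun _ => ξ)

/-- The squared norm is that of `⟨ξ, k(s,s)((e - e')²) ξ⟩`. Replacing `e²` by `e` and `e'²` by `e'`
only enlarges it and leaves an expression affine in `e`, whose limit strictness provides. -/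
theorem norm_elem_sub_elem_sq_le (s : S) (ξ : F) {e e' : A} (he : 0 ≤ e) (he1 : ‖e‖ ≤ 1)
    (he' : 0 ≤ e') (he1' : ‖e'‖ ≤ 1) :
    ‖elem.{u, v, w, x, y} hk e s ξ - hk.elem e' s ξ‖ ^ 2 ≤
      ‖rightInner B ξ (kernelCLM k s s (e - e * e' - e' * e + e') ξ)‖ := by
  rw [norm_sq_eq_norm_rightInner B]
  refine CStarAlgebra.norm_le_norm_of_nonneg_of_le (rightInner_self_nonneg B _) ?_
  have hse : star e = e := (IsSelfAdjoint.of_nonneg he).star_eq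
  have hse' : star e' = e' := (IsSelfAdjoint.of_nonneg he').star_eq
  have h1 := hk.rightInner_nonneg_of_nonneg s
    (sub_nonneg.2 (mul_self_le_self_of_nonneg_of_norm_le_one he he1)) ξ
  have h2 := hk.rightInner_nonneg_of_nonneg s
    (sub_nonneg.2 (mul_self_le_self_of_nonneg_of_norm_le_one he' he1')) ξ
  rw [← sub_nonneg]
  convert add_nonneg h1 h2 using 1
  simp only [rightInner_sub_left, rightInner_sub_right, rightInner_elem_elem, hse, hse']
  change _ = rightInner B ξ (kernelCLM k s s _ ξ) + rightInner B ξ (kernelCLM k s s _ ξ)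
  change rightInner B ξ (kernelCLM k s s _ ξ) - (rightInner B ξ (kernelCLM k s s _ ξ) -
    rightInner B ξ (kernelCLM k s s _ ξ) - (rightInner B ξ (kernelCLM k s s _ ξ) -
    rightInner B ξ (kernelCLM k s s _ ξ))) = _
  simp only [map_sub, map_add, sub_apply, add_apply,
    rightInner_sub_right, rightInner_add_right]
  abel

/-- For fixed `e'` the bound of `norm_elem_sub_elem_sq_le` tends, as `e` runs along `l`, to `‖⟨ξ, R
ξ⟩ - ⟨ξ, k(s,s)(e') ξ⟩‖`. This tends to `0` in `e'`, so a suitable `e'` is the centre of a small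
ball containing all later vectors. -/
theorem exists_tendsto_elem {l : Filter A} (hl : l.IsIncreasingApproximateUnit) {s : S}
    (hs : IsStrictAlong (k s s) l) (ξ : F) :
    ∃ z, Tendsto (fun e => elem.{u, v, w, x, y} hk e s ξ) l (𝓝 z) := by
  obtain ⟨R, hR, -⟩ := hs
  have := hl.neBot
  refine cauchy_map_iff_exists_tendsto.1 (Metric.cauchy_iff.2 ⟨inferInstance, fun ε hε => ?_⟩)
  have hg : ∀ e', Tendsto (fun e => ‖rightInner B ξ (kernelCLM k s s (e - e * e' - e' * e + e') ξ)‖)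
      l (𝓝 ‖rightInner B ξ (R ξ) - rightInner B ξ (kernelCLM k s s e' ξ)‖) := fun e' => by
    have h1 : Tendsto (fun e => kernelCLM k s s e ξ - kernelCLM k s s (e * e') ξ
        - kernelCLM k s s (e' * e) ξ + kernelCLM k s s e' ξ) l
        (𝓝 (R ξ - kernelCLM k s s e' ξ - kernelCLM k s s e' ξ + kernelCLM k s s e' ξ)) :=
      (((hR ξ).sub (tendsto_kernelCLM s s ξ (hl.tendsto_mul_right e'))).sub
        (tendsto_kernelCLM s s ξ (hl.tendsto_mul_left e'))).add tendsto_const_nhds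
    rw [sub_add_cancel] at h1
    have h2 := ((tendsto_const_nhds (x := ξ)).rightInner (B := B) h1).norm
    rw [rightInner_sub_right] at h2
    simpa only [map_sub, map_add, sub_apply,
      add_apply] using h2
  have hR' : Tendsto (fun e' => ‖rightInner B ξ (R ξ) - rightInner B ξ (kernelCLM k s s e' ξ)‖)
      l (𝓝 0) := by
    have h1 := (tendsto_const_nhds (x := rightInner B ξ (R ξ))).sub
      ((tendsto_const_nhds (x := ξ)).rightInner (B := B) (hR ξ))
    have h2 := h1.norm
    rw [sub_self, norm_zero] at h2
    exact h2
  -- The estimate concerns the squared distance, and two points of a ball of radius `ε / 2` are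
  -- within `ε`.
  have hpos : (0 : ℝ) < (ε / 2) ^ 2 := by positivity
  obtain ⟨e', ⟨he', he0'⟩, he1'⟩ := ((hR'.eventually_lt_const hpos).and
    hl.eventually_nonneg |>.and hl.eventually_norm).exists
  refine ⟨Metric.ball (hk.elem e' s ξ) (ε / 2), ?_, fun z hz z' hz' => ?_⟩
  · rw [mem_map]
    filter_upwards [(hg e').eventually_lt_const he', hl.eventually_nonneg, hl.eventually_norm]
      with e h0 h1 h2
    have h3 := (hk.norm_elem_sub_elem_sq_le s ξ h1 h2 he0' he1').trans_lt h0
    rw [Set.mem_preimage, mem_ball_iff_norm]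
    exact (sq_lt_sq₀ (norm_nonneg _) (by positivity)).1 h3
  · have := dist_triangle_right z z' (hk.elem e' s ξ)
    rw [Metric.mem_ball] at hz hz'
    linarith

/-- The vectors `e ⊗ s ⊗ ξ` converge along an approximate unit, and the limit depends on `ξ`
linearly and boundedly. -/
theorem exists_forall_rightInner_elem
    (hs : ∀ s, ∃ l : Filter A, l.IsIncreasingApproximateUnit ∧ IsStrictAlong (k s s) l) (s : S) :
    ∃ T : F →L[ℂ] (preHilbertModule.{u, v, w, x, y} hk).Completion,
      (∀ ξ b t η, rightInner B (T ξ) (hk.elem b t η) = rightInner B ξ (k s t b η)) ∧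
      ∀ a ξ, hk.leftAction a (T ξ) = hk.elem a s ξ := by
  obtain ⟨l, hl, hls⟩ := hs s
  have := hl.neBot
  choose T hT using fun ξ => exists_tendsto_elem.{u, v, w, x, y} hk hl hls ξ
  refine ⟨LinearMap.mkContinuous
    { toFun := T
      map_add' := fun ξ η => tendsto_nhds_unique (hT (ξ + η)) (by
        simpa only [elem_add_right] using (hT ξ).add (hT η))
      map_smul' := fun c ξ => tendsto_nhds_unique (hT (c • ξ)) (by
        simpa only [elem_smul_right, RingHom.id_apply] using (hT ξ).const_smul c) }
    (√‖kernelCLM k s s‖) (fun ξ => ?_), fun ξ b t η => ?_, fun a ξ => ?_⟩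
  · refine le_of_tendsto (hT ξ).norm (hl.eventually_norm.mono fun e he => ?_)
    refine (hk.norm_elem_le e s ξ).trans ?_
    gcongr
    exact mul_le_of_le_one_right (Real.sqrt_nonneg _) he
  · refine tendsto_nhds_unique ((hT ξ).rightInner (B := B) tendsto_const_nhds) ?_
    refine ((tendsto_const_nhds (x := ξ)).rightInner (B := B)
      (tendsto_kernelCLM s t η (hl.tendsto_mul_right b))).congr' ?_
    filter_upwards [hl.eventually_star_eq] with e he
    rw [rightInner_elem_elem, he]
    rfl
  -- Applying `a` gives `(a e) ⊗ s ⊗ ξ`, which tends to `a ⊗ s ⊗ ξ` because `a e → a` and elementary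
  -- vectors depend boundedly on `a`.
  · refine tendsto_nhds_unique (((hk.leftAction a).1.continuous.tendsto _).comp (hT ξ)) ?_
    simp only [Function.comp_def, leftAction_elem]
    have h : ∀ e, hk.elem (a * e) s ξ - hk.elem a s ξ =
        elem.{u, v, w, x, y} hk (a * e - a) s ξ := by
      intro e
      rw [sub_eq_iff_eq_add, ← elem_add_left, sub_add_cancel]
    rw [tendsto_iff_norm_sub_tendsto_zero]
    have h0 := ((tendsto_iff_norm_sub_tendsto_zero.1 (hl.tendsto_mul_left a)).const_mul
      (√‖kernelCLM k s s‖)).mul_const ‖ξ‖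
    rw [mul_zero, zero_mul] at h0
    refine squeeze_zero (fun _ => norm_nonneg _) (fun e => ?_) h0
    rw [h]
    exact hk.norm_elem_le _ s ξ

variable [CompleteSpace F]

/-- The candidate adjoint `b ⊗ t ⊗ η ↦ k(s,t)(b) η` is defined on formal combinations as `f`. Its
bound comes from duality with `T`: `‖f g‖² = ‖⟨T (f g), g⟩‖ ≤ ‖T‖ ‖f g‖ ‖g‖`. Completeness of `F`
then lets it extend. -/
theorem exists_adjointable
    (hs : ∀ s, ∃ l : Filter A, l.IsIncreasingApproximateUnit ∧ IsStrictAlong (k s s) l) (s : S) :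
    ∃ T : Adjointable B F (preHilbertModule.{u, v, w, x, y} hk).Completion,
      (∀ b t η, T.adjoint (hk.elem b t η) = k s t b η) ∧
      ∀ a ξ, hk.leftAction a (T ξ) = hk.elem a s ξ := by
  obtain ⟨T, hT, hT'⟩ := exists_forall_rightInner_elem.{u, v, w, x, y} hk hs s
  let f : (KernelIndex.{u, w, x, y} A S F →₀ ℂ) →ₗ[ℂ] F :=
    Finsupp.linearCombination ℂ fun p => k s p.point p.left p.vec
  have hf : ∀ ξ g, rightInner B (T ξ) (hk.preHilbertModule.toCompl g) = rightInner B ξ (f g) := by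
    intro ξ g
    induction g using Finsupp.induction_linear with
    | zero => simp [rightInner]
    | add g g' hg hg' => rw [map_add, map_add, rightInner_add_right, rightInner_add_right, hg, hg']
    | single p c =>
      rw [← mul_one c, ← smul_eq_mul, ← Finsupp.smul_single, map_smul, map_smul,
        rightInner_smul_right, rightInner_smul_right]
      congr 1
      rw [Finsupp.linearCombination_single, one_smul]
      exact hT ξ p.left p.point p.vec
  have hb : ∀ g, ‖f g‖ ≤ ‖T‖ * ‖hk.preHilbertModule.toCompl g‖ := by
    intro g
    rcases (norm_nonneg (f g)).eq_or_lt with h0 | h0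
    · rw [← h0]; positivity
    · refine le_of_mul_le_mul_left ?_ h0
      rw [← sq, norm_sq_eq_norm_rightInner B, ← hf]
      refine (norm_rightInner_le _ _).trans ?_
      rw [← mul_assoc, mul_comm ‖f g‖]
      gcongr
      exact T.le_opNorm _
  have hadj : ∀ ξ z, rightInner B (T ξ) z = rightInner B ξ (hk.preHilbertModule.lift f z) := by
    intro ξ z
    refine hk.preHilbertModule.toCompl_induction ?_ (fun g => ?_) z
    · exact isClosed_eq (continuous_const.rightInner continuous_id)
        (continuous_const.rightInner (hk.preHilbertModule.lift f).continuous)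
    · rw [hf, hk.preHilbertModule.lift_toCompl _ hb]
  refine ⟨⟨T, hk.preHilbertModule.lift f, hadj⟩, fun b t η => ?_, hT'⟩
  refine rightInner_left_injective B fun ξ => ?_
  rw [Adjointable.rightInner_adjoint_right]
  exact hT ξ b t η

/-- The minimal correspondence of a strict positive-definite kernel. -/
theorem exists_minimal
    (hs : ∀ s, ∃ l : Filter A, l.IsIncreasingApproximateUnit ∧ IsStrictAlong (k s s) l) :
    ∃ (E : CStarCorrespondence.{u, v, max u w x y} A B) (ζ : S → Adjointable B F E),
      IsDecomposition k E ζ ∧ IsMinimalPair E ζ := by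
  choose ζ h1 h2 using exists_adjointable.{u, v, w, x, y} hk hs
  let E : CStarCorrespondence.{u, v, max u w x y} A B :=
    { carrier := (preHilbertModule.{u, v, w, x, y} hk).Completion
      leftAction := hk.leftAction
      nondegenerate := by
        refine hk.dense_span_elem.mono (Submodule.span_mono ?_)
        rintro _ ⟨a, s, ξ, rfl⟩
        exact ⟨a, ζ s ξ, (h2 s a ξ).symm⟩ }
  refine ⟨E, ζ, fun s t a => Adjointable.ext' fun ξ => ?_, ?_⟩
  · change k s t a ξ = (ζ s).adjoint (hk.leftAction a (ζ t ξ))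
    rw [h2, h1]
  · refine hk.dense_span_elem.mono (Submodule.span_mono ?_)
    rintro _ ⟨a, s, ξ, rfl⟩
    exact ⟨a, s, ξ, (h2 s a ξ).symm⟩

end IsPositiveDefiniteKernel

/-! ### Consequences of a decomposition and uniqueness of minimal pairs -/

section Decomposition

variable {A : Type u} [NonUnitalCStarAlgebra A]
  {B : Type v} [NonUnitalCStarAlgebra B] [PartialOrder B] [StarOrderedRing B]
  {F : Type w} [NormedAddCommGroup F] [NormedSpace ℂ F] [SMul Bᵐᵒᵖ F] [CStarModule Bᵐᵒᵖ F]
  {S : Type x} {k : S → S → A →L[ℂ] Adjointable B F F}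
  {E : CStarCorrespondence.{u, v, y₁} A B} {ζ : S → Adjointable B F E}
  {E' : CStarCorrespondence.{u, v, y₂} A B} {ζ' : S → Adjointable B F E'}

omit [StarOrderedRing B] in
theorem IsDecomposition.rightInner_eq (h : IsDecomposition k E ζ) (s t : S) (a b : A) (ξ η : F) :
    rightInner B (E.leftAction a (ζ s ξ)) (E.leftAction b (ζ t η)) =
      rightInner B ξ (k s t (star a * b) η) := by
  rw [h s t, Adjointable.comp_apply, Adjointable.rightInner_adjoint_right, Adjointable.comp_apply,
    E.leftAction_mul_apply, E.rightInner_leftAction_right (star a), star_star]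

omit [StarOrderedRing B] in
theorem IsDecomposition.isPositiveDefiniteKernel (h : IsDecomposition k E ζ) :
    IsPositiveDefiniteKernel k := by
  intro n s a ξ
  convert rightInner_self_nonneg B (∑ i, E.leftAction (a i) (ζ (s i) (ξ i)))
  simp only [rightInner_sum_left, rightInner_sum_right, h.rightInner_eq]
  exact Finset.sum_comm

/-- The limit is `ζ(s)* ζ(s)`, since `φ(e) → 1` pointwise. It is self-adjoint, as is `k(s,s)(e)` for
self-adjoint `e`, so convergence of the adjoints is the same statement. -/
theorem IsDecomposition.isStrictAlong [PartialOrder A] [StarOrderedRing A]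
    (h : IsDecomposition k E ζ) (s : S) {l : Filter A}
    (hl : l.IsIncreasingApproximateUnit) : IsStrictAlong (k s s) l := by
  have h1 : ∀ ξ, Tendsto (fun e => k s s e ξ) l
      (𝓝 ((ζ s).adjoint (ζ s ξ))) := fun ξ => by
    simp only [h s s]
    exact ((ζ s).adjoint.1.continuous.tendsto _).comp (E.tendsto_leftAction hl (ζ s ξ))
  refine ⟨(ζ s).adjoint.comp (ζ s), h1, fun ξ => ?_⟩
  have h2 : ((ζ s).adjoint.comp (ζ s)).adjoint = (ζ s).adjoint.comp (ζ s) :=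
    (Adjointable.eq_adjoint fun ξ η => by
      rw [Adjointable.comp_apply, Adjointable.comp_apply, Adjointable.rightInner_adjoint_right,
        Adjointable.rightInner_adjoint_left]).symm
  rw [h2]
  refine (h1 ξ).congr' ?_
  filter_upwards [hl.eventually_star_eq] with e he
  have h3 : k s s e = (k s s e).adjoint := Adjointable.eq_adjoint fun ξ η => by
    rw [h s s]
    simp only [Adjointable.comp_apply]
    rw [Adjointable.rightInner_adjoint_right, Adjointable.rightInner_adjoint_left,
      E.rightInner_leftAction_right, he]
  exact congrArg (fun T : Adjointable B F F => T ξ) h3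

/-- The linear map from combinations of elementary vectors defined by a pair `(ζ, E)`. -/
noncomputable def CStarCorrespondence.realize (E : CStarCorrespondence.{u, v, y₁} A B)
    (ζ : S → Adjointable B F E) : (A × S × F →₀ ℂ) →ₗ[ℂ] E :=
  Finsupp.linearCombination ℂ fun p => E.leftAction p.1 (ζ p.2.1 p.2.2)

omit [StarOrderedRing B] in
theorem IsMinimalPair.denseRange_realize (h : IsMinimalPair E ζ) : DenseRange (E.realize ζ) := by
  refine h.mono ?_
  have h1 : {z : E | ∃ (a : A) (s : S) (ξ : F), z = E.leftAction a (ζ s ξ)} =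
      Set.range fun p : A × S × F => E.leftAction p.1 (ζ p.2.1 p.2.2) := by
    ext z
    constructor
    · rintro ⟨a, s, ξ, rfl⟩
      exact ⟨(a, s, ξ), rfl⟩
    · rintro ⟨p, rfl⟩
      exact ⟨p.1, p.2.1, p.2.2, rfl⟩
  rw [h1, ← Finsupp.range_linearCombination]
  exact subset_rfl

-- Both sides are the same expression in `k`; this is the isometry behind uniqueness.
omit [StarOrderedRing B] in
theorem IsDecomposition.rightInner_realize (h : IsDecomposition k E ζ)
    (h' : IsDecomposition k E' ζ') (f g : A × S × F →₀ ℂ) :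
    rightInner B (E.realize ζ f) (E.realize ζ g) =
      rightInner B (E'.realize ζ' f) (E'.realize ζ' g) := by
  simp only [CStarCorrespondence.realize, Finsupp.linearCombination_apply, Finsupp.sum,
    rightInner_sum_left, rightInner_sum_right, rightInner_smul_left, rightInner_smul_right,
    h.rightInner_eq, h'.rightInner_eq]

omit [StarOrderedRing B] in
theorem IsMinimalPair.clm_ext {X : Type*} [NormedAddCommGroup X] [NormedSpace ℂ X]
    (h : IsMinimalPair E ζ) {T R : E →L[ℂ] X}
    (hTR : ∀ a s ξ, T (E.leftAction a (ζ s ξ)) = R (E.leftAction a (ζ s ξ))) : T = R := by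
  refine ContinuousLinearMap.ext_on h ?_
  rintro _ ⟨a, s, ξ, rfl⟩
  exact hTR a s ξ

/-- The comparison map between two decompositions of a kernel. -/
noncomputable def comparison (ζ : S → Adjointable B F E) (ζ' : S → Adjointable B F E') :
    E →L[ℂ] E' := (E'.realize ζ').extendOfNorm (E.realize ζ)

omit [StarOrderedRing B] in
theorem comparison_realize (hm : IsMinimalPair E ζ) (h : IsDecomposition k E ζ)
    (h' : IsDecomposition k E' ζ') (f : A × S × F →₀ ℂ) :
    comparison ζ ζ' (E.realize ζ f) = E'.realize ζ' f := by
  refine LinearMap.extendOfNorm_eq hm.denseRange_realize ⟨1, fun f => ?_⟩ f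
  rw [one_mul, ← sq_le_sq₀ (norm_nonneg _) (norm_nonneg _), norm_sq_eq_norm_rightInner B,
    norm_sq_eq_norm_rightInner B, h.rightInner_realize h']

omit [StarOrderedRing B] in
theorem comparison_leftAction (hm : IsMinimalPair E ζ) (h : IsDecomposition k E ζ)
    (h' : IsDecomposition k E' ζ') (a : A) (s : S) (ξ : F) :
    comparison ζ ζ' (E.leftAction a (ζ s ξ)) = E'.leftAction a (ζ' s ξ) := by
  simpa [CStarCorrespondence.realize] using
    comparison_realize hm h h' (Finsupp.single (a, s, ξ) 1)

/-- The comparison map in the opposite direction serves as adjoint, so adjointability needs no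
separate construction. -/
theorem rightInner_comparison (hm : IsMinimalPair E ζ) (hm' : IsMinimalPair E' ζ')
    (h : IsDecomposition k E ζ) (h' : IsDecomposition k E' ζ') (z : E) (z' : E') :
    rightInner B (comparison ζ ζ' z) z' = rightInner B z (comparison ζ' ζ z') := by
  refine hm.denseRange_realize.induction_on z ?_ fun f => ?_
  · exact isClosed_eq ((comparison ζ ζ').continuous.rightInner continuous_const)
      (continuous_id.rightInner continuous_const)
  refine hm'.denseRange_realize.induction_on z' ?_ fun g => ?_
  · exact isClosed_eq (continuous_const.rightInner continuous_id)
      (continuous_const.rightInner (comparison ζ' ζ).continuous)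
  rw [comparison_realize hm h h', comparison_realize hm' h' h, h.rightInner_realize h']

/-- Minimal decompositions of a kernel are unique up to a unique unitary isomorphism. -/
theorem existsUnique_isUnitaryIso (h : IsDecomposition k E ζ) (hm : IsMinimalPair E ζ)
    (h' : IsDecomposition k E' ζ') (hm' : IsMinimalPair E' ζ') :
    ∃! U : Adjointable B E E',
      CStarCorrespondence.IsUnitaryIso U ∧ ∀ s, U.comp (ζ s) = ζ' s := by
  let U : Adjointable B E E' :=
    ⟨comparison ζ ζ', comparison ζ' ζ, rightInner_comparison hm hm' h h'⟩
  let V : Adjointable B E' E :=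
    ⟨comparison ζ' ζ, comparison ζ ζ', rightInner_comparison hm' hm h' h⟩
  have hV : V = U.adjoint :=
    Adjointable.eq_adjoint fun z z' => (rightInner_comparison hm hm' h h' z z').symm
  have hint : ∀ a : A, U.comp (E.leftAction a) = (E'.leftAction a).comp U := fun a => by
    refine Subtype.ext (hm.clm_ext fun b s ξ => ?_)
    change comparison ζ ζ' (E.leftAction a (E.leftAction b (ζ s ξ))) =
      E'.leftAction a (comparison ζ ζ' (E.leftAction b (ζ s ξ)))
    rw [← E.leftAction_mul_apply, comparison_leftAction hm h h', comparison_leftAction hm h h',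
      E'.leftAction_mul_apply]
  refine ⟨U, ⟨⟨⟨?_, ?_⟩, hint⟩, fun s => Adjointable.ext' fun ξ => ?_⟩, ?_⟩
  · rw [← hV]
    refine Subtype.ext (hm.clm_ext fun b s ξ => ?_)
    change comparison ζ' ζ (comparison ζ ζ' (E.leftAction b (ζ s ξ))) = _
    rw [comparison_leftAction hm h h', comparison_leftAction hm' h' h]
    rfl
  · rw [← hV]
    refine Subtype.ext (hm'.clm_ext fun b s ξ => ?_)
    change comparison ζ ζ' (comparison ζ' ζ (E'.leftAction b (ζ' s ξ))) = _
    rw [comparison_leftAction hm' h' h, comparison_leftAction hm h h']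
    rfl
  -- `U` is known only on vectors `a ζ(s) ξ`. Intertwining gives `a U ζ(s) ξ = a ζ'(s) ξ` for every
  -- `a`, and nondegeneracy of `E'` removes `a`.
  · refine sub_eq_zero.1 (E'.eq_zero_of_forall_leftAction_eq_zero fun a => ?_)
    rw [map_sub, sub_eq_zero]
    change ((E'.leftAction a).comp U) (ζ s ξ) = _
    rw [← hint a]
    exact comparison_leftAction hm h h' a s ξ
  · rintro U' ⟨⟨-, hint'⟩, hU'⟩
    refine Subtype.ext (hm.clm_ext fun b s ξ => ?_)
    change (U'.comp (E.leftAction b)) (ζ s ξ) = comparison ζ ζ' _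
    rw [hint', comparison_leftAction hm h h', ← hU' s]
    rfl

end Decomposition

/-! ### The theorem -/

theorem mainTheorem3
    {A : Type u} [NonUnitalCStarAlgebra A] [PartialOrder A] [StarOrderedRing A]
    {B : Type v} [NonUnitalCStarAlgebra B] [PartialOrder B] [StarOrderedRing B]
    {F : Type w} [NormedAddCommGroup F] [NormedSpace ℂ F] [CompleteSpace F]
    [SMul Bᵐᵒᵖ F] [CStarModule Bᵐᵒᵖ F]
    {S : Type x} (k : S → S → A →L[ℂ] Adjointable B F F) :
    -- the equivalence; strictness may be tested on some or on all approximate units of `A`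
    List.TFAE
      [∃ (E : CStarCorrespondence.{u, v, max u w x y} A B) (ζ : S → Adjointable B F E),
          IsDecomposition k E ζ,
        IsPositiveDefiniteKernel k ∧
          ∀ s, ∃ l : Filter A, l.IsIncreasingApproximateUnit ∧ IsStrictAlong (k s s) l,
        IsPositiveDefiniteKernel k ∧
          ∀ s, ∀ l : Filter A, l.IsIncreasingApproximateUnit → IsStrictAlong (k s s) l] ∧
    -- existence of a minimal pair
    ((IsPositiveDefiniteKernel k ∧
          ∀ s, ∃ l : Filter A, l.IsIncreasingApproximateUnit ∧ IsStrictAlong (k s s) l) →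
      ∃ (E : CStarCorrespondence.{u, v, max u w x y} A B) (ζ : S → Adjointable B F E),
        IsDecomposition k E ζ ∧ IsMinimalPair E ζ) ∧
    -- uniqueness of minimal pairs
    (∀ (E : CStarCorrespondence.{u, v, y₁} A B) (ζ : S → Adjointable B F E)
        (E' : CStarCorrespondence.{u, v, y₂} A B) (ζ' : S → Adjointable B F E'),
      IsDecomposition k E ζ → IsMinimalPair E ζ →
      IsDecomposition k E' ζ' → IsMinimalPair E' ζ' →
        ∃! U : Adjointable B E E',
          CStarCorrespondence.IsUnitaryIso U ∧ ∀ s, U.comp (ζ s) = ζ' s) := by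
  refine ⟨?_, fun h => h.1.exists_minimal h.2, fun E ζ E' ζ' h hm h' hm' =>
    existsUnique_isUnitaryIso h hm h' hm'⟩
  tfae_have 1 → 3 := fun ⟨_, _, h⟩ =>
    ⟨h.isPositiveDefiniteKernel, fun s _ hl => h.isStrictAlong s hl⟩
  -- Passing from every approximate unit to some requires that one exists.
  tfae_have 3 → 2 := fun h => ⟨h.1, fun s => ⟨_, CStarAlgebra.increasingApproximateUnit A,
    h.2 s _ (CStarAlgebra.increasingApproximateUnit A)⟩⟩
  -- The universe `y`, carried by `KernelIndex`, is given explicitly so that the constructed `E`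
  -- lies in the universe of the statement.
  tfae_have 2 → 1 := fun h =>
    have ⟨E, ζ, hd, _⟩ := IsPositiveDefiniteKernel.exists_minimal.{u, v, w, x, y} h.1 h.2
    ⟨E, ζ, hd⟩
  tfae_finish
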